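/- \textbf{Setting.} Let $m\ge 1$, $n\ge 0$. Agents $i\in\mathcal M=\{1,\dots,m\}$ have convex functions $f_i:\mathbb R^n\to\mathbb R$ and nonempty closed convex sets $X_i\subseteq\mathbb R^n$; $P_{X_i}$ is Euclidean projection onto $X_i$ and $\|\cdot\|$ the Euclidean norm. Let $n(0),n(1),\dots$ be i.i.d. random elements of a measurable space $\Omega'$ (the coordinates of the product probability space $\prod_{k}(\Omega',P')$), let $\psi:(\mathbb R^n)^m\times\Omega'\to\mathbb R^{m\times m}$ be measurable, and let $\alpha(k)>0$ be stepsizes. Starting from deterministic $x_i(0)\in X_i$, the states $x(k)=(x_i(k))_{i\in\mathcal M}$ evolve by $$A(k)=[a_{ij}(k)]=\psi(x(k),n(k)),\quad v_i(k)=\sum_{j=1}^m a_{ij}(k)x_j(k),\quad x_i(k+1)=P_{X_i}\big[v_i(k)-\alpha(k)d_i(k)\big],$$ where $d_i(k)$ is a subgradient of $f_i$ at $v_i(k)$, chosen as a measurable function of $(x(k),n(k))$ which may depend on $k$ and $i$. The projection errors are $e_i(k)=P_{X_i}[v_i(k)-\alpha(k)d_i(k)]-(v_i(k)-\alpha(k)d_i(k))$.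 Thus $x(k)$ is a (time-nonhomogeneous) Markov chain. For a state $\bar x\in(\mathbb R^n)^m$, write $P(\,\cdot\mid x(s)=\bar x)$ and $E[\,\cdot\mid x(s)=\bar x]$ for the law and expectation of the process $(x(k),A(k))_{k\ge s}$ obtained by running the recursion from time $s$ with $x(s)=\bar x$ and the independent noise $n(s),n(s+1),\dots$. \textbf{Assumptions.} \begin{itemize} \item (Bounded subgradients) $L>0$ and $\|d\|\le L$ for all $i$, all $x\in\mathbb R^n$ and all $d\in\partial f_i(x)$. \item (Connectivity) $(\mathcal M,\mathcal E)$ is a strongly connected directed graph, and there are $\gamma,K,C>0$, $\delta\in(0,1]$ such that for all $(j,i)\in\mathcal E$, all $\bar x\in(\mathbb R^n)^m$ and all $k\ge0$, $$P(a_{ij}(k)\ge\gamma\mid x(k)=\bar x)\ge\min\Big\{\delta,\frac{K}{\|\bar x_i-\bar x_j\|^C}\Big\}\qquad(K/0=\infty).$$ \item With probability one, for all $k\ge0$: (doubly stochastic weights) $A(k)$ is doubly stochastic; (self-confidence) $a_{ii}(k)\ge\gamma$ for all $i$; (projection errors) $\|e_i(k)\|\le M\alpha(k)$ for all $i$, where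 $M>0$ is a constant. \item (Limiting stepsizes) $\lim_{k\to\infty}k\log^p(k)\,\alpha(k)=0$ for every real $p<1$. \end{itemize} \textbf{Notation.} For $k\ge s\ge 0$ let $\Phi(k,s)=A(k)A(k-1)\cdots A(s)$ and $$\rho(k,s)=\max_{i,j\in\mathcal M}\Big|[\Phi(k,s)]_{ij}-\frac1m\Big|.$$ With $\Delta=2m\max_{j}\|x_j(0)\|$ let $$R_M(s)=\Big\{x\in(\mathbb R^n)^m:\ \max_{i,h\in\mathcal M}\|x_i-x_h\|\le\Delta+2m(L+M)\sum_{r=0}^{s-1}\alpha(r)\Big\}.$$ \textbf{Proposition.} Under these assumptions there are $\mu>0$, an increasing function $\beta:\mathbb N\to[0,\infty)$ and a function $S:(0,\infty)\to\mathbb N$ with $\beta(s)\le s^q$ for all real $q>0$ and all $s\ge S(q)$, such that for all $k\ge s\ge0$: \begin{enumerate} \item[(i)] $E[\rho(k,s)\mid x(s)=\bar x]\le\beta(s)e^{-\mu\sqrt{k-s}}$ for every $\bar x\in R_M(s)$ such that the three almost sure properties assumed of the process (doubly stochastic $A(k')$, $a_{ii}(k')\ge\gamma$, $\|e_i(k')\|\le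 M\alpha(k')$, for all $i$ and all $k'\ge s$) hold with probability one given $x(s)=\bar x$; \item[(ii)] for the process started from $x(0)$, almost surely $E[\rho(k,s)\mid x(s)]\le\beta(s)e^{-\mu\sqrt{k-s}}$. \end{enumerate} The random variables $\rho(k,s)$ in (i) and (ii) are integrable, and the same $\mu$ and $\beta$ also work if $\Phi(k,s)$ is replaced by the product $A(s)A(s+1)\cdots A(k)$ in the opposite order. -/

import Mathlib

open MeasureTheory Filter Topology

/-- The joint state of `m` agents: one vector of the Euclidean space `ℝⁿ` for each agent. -/
abbrev AgentState (m n : ℕ) : Type := Fin m → EuclideanSpace ℝ (Fin n)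

/-- The set `∂f(x)` of subgradients at `x` of a real-valued function on `ℝⁿ`. -/
def subgradients {n : ℕ} (f : EuclideanSpace ℝ (Fin n) → ℝ) (x : EuclideanSpace ℝ (Fin n)) :
    Set (EuclideanSpace ℝ (Fin n)) :=
  {g | ∀ y, f x + inner ℝ g (y - x) ≤ f y}

/-- The projection of `x` on `X`, i.e. the minimizer of `‖x - y‖` over `y ∈ X`
(it exists and is unique if `X` is nonempty, closed and convex). -/
noncomputable def projOn {n : ℕ} (X : Set (EuclideanSpace ℝ (Fin n)))
    (x : EuclideanSpace ℝ (Fin n)) : EuclideanSpace ℝ (Fin n) :=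
  Classical.epsilon fun y => y ∈ X ∧ IsMinOn (fun z => ‖x - z‖) X y

/-- The data of the projected multi-agent subgradient algorithm with `m` agents in `ℝⁿ` and
state-dependent communication. The noise at each time takes values in `W`. -/
structure SubgradientNetwork (m n : ℕ) (W : Type*) [MeasurableSpace W] where
  /-- local objective functions -/
  f : Fin m → EuclideanSpace ℝ (Fin n) → ℝ
  convex_f : ∀ i, ConvexOn ℝ Set.univ (f i)
  /-- local constraint sets -/
  X : Fin m → Set (EuclideanSpace ℝ (Fin n))
  nonempty_X : ∀ i, (X i).Nonempty
  closed_X : ∀ i, IsClosed (X i)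
  convex_X : ∀ i, Convex ℝ (X i)
  /-- stepsizes -/
  α : ℕ → ℝ
  α_pos : ∀ k, 0 < α k
  /-- the communication matrix as a function of the state and of the noise -/
  ψ : AgentState m n → W → Matrix (Fin m) (Fin m) ℝ
  measurable_ψ : ∀ i j, Measurable fun p : AgentState m n × W => ψ p.1 p.2 i j
  /-- the subgradient used by an agent at a time, given the state and the noise at that time -/
  d : ℕ → Fin m → AgentState m n → W → EuclideanSpace ℝ (Fin n)
  measurable_d : ∀ k i, Measurable fun p : AgentState m n × W => d k i p.1 p.2
  d_mem : ∀ k i x w, d k i x w ∈ subgradients (f i) (∑ j, ψ x w i j • x j)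
  /-- initial estimates -/
  x₀ : AgentState m n
  x₀_mem : ∀ i, x₀ i ∈ X i

namespace SubgradientNetwork

variable {m n : ℕ} {W : Type*} [MeasurableSpace W]

/-- The point `v_i - α(k) d_i` with `v_i = ∑ⱼ a_ij x_j`, before projection. -/
noncomputable def preStep (N : SubgradientNetwork m n W) (k : ℕ) (x : AgentState m n) (w : W) :
    AgentState m n :=
  fun i => ∑ j, N.ψ x w i j • x j - N.α k • N.d k i x w

/-- The state at time `k + 1`, if the state at time `k` is `x` and the noise is `w`. -/
noncomputable def step (N : SubgradientNetwork m n W) (k : ℕ) (x : AgentState m n) (w : W) :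
    AgentState m n :=
  fun i => projOn (N.X i) (N.preStep k x w i)

/-- The projection error `e_i(k)`, if the state at time `k` is `x` and the noise is `w`. -/
noncomputable def projError (N : SubgradientNetwork m n W) (k : ℕ) (x : AgentState m n) (w : W)
    (i : Fin m) : EuclideanSpace ℝ (Fin n) :=
  projOn (N.X i) (N.preStep k x w i) - N.preStep k x w i

/-- The state at time `k` of the algorithm that is in state `y` at time `s`, along the noise
sequence `ω` (only meaningful for `s ≤ k`; it is `y` for `k ≤ s`). -/
noncomputable def stateFrom (N : SubgradientNetwork m n W) (s : ℕ) (y : AgentState m n)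
    (ω : ℕ → W) : ℕ → AgentState m n
  | 0 => y
  | k + 1 => if s ≤ k then N.step k (N.stateFrom s y ω k) (ω k) else y

/-- The communication matrix `A(k) = ψ(x(k), n(k))` of the algorithm in state `y` at time `s`. -/
noncomputable def weightsFrom (N : SubgradientNetwork m n W) (s : ℕ) (y : AgentState m n)
    (ω : ℕ → W) (k : ℕ) : Matrix (Fin m) (Fin m) ℝ :=
  N.ψ (N.stateFrom s y ω k) (ω k)

/-- The law of the noise sequence: independent, with common law `P`. -/
noncomputable def noiseLaw (P : Measure W) [IsProbabilityMeasure P] : Measure (ℕ → W) :=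
  Measure.infinitePi fun _ : ℕ => P

/-- With probability one, all communication matrices of the algorithm that is in state `y` at time
`s` are doubly stochastic from time `s` on. -/
def DoublyStochasticFrom (N : SubgradientNetwork m n W) (P : Measure W) [IsProbabilityMeasure P]
    (s : ℕ) (y : AgentState m n) : Prop :=
  ∀ᵐ ω ∂(noiseLaw P), ∀ k, s ≤ k → N.weightsFrom s y ω k ∈ doublyStochastic ℝ (Fin m)

/-- With probability one, all agents of the algorithm that is in state `y` at time `s` give weight
at least `γ` to themselves from time `s` on. -/
def SelfConfidentFrom (N : SubgradientNetwork m n W) (P : Measure W) [IsProbabilityMeasure P]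
    (γ : ℝ) (s : ℕ) (y : AgentState m n) : Prop :=
  ∀ᵐ ω ∂(noiseLaw P), ∀ k, s ≤ k → ∀ i, γ ≤ N.weightsFrom s y ω k i i

/-- With probability one, the projection errors of the algorithm that is in state `y` at time `s`
are bounded by `M α(k)` from time `s` on. -/
def ProjErrorBoundedFrom (N : SubgradientNetwork m n W) (P : Measure W) [IsProbabilityMeasure P]
    (M : ℝ) (s : ℕ) (y : AgentState m n) : Prop :=
  ∀ᵐ ω ∂(noiseLaw P), ∀ k, s ≤ k → ∀ i,
    ‖N.projError k (N.stateFrom s y ω k) (ω k) i‖ ≤ M * N.α k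

/-- The set `R_M(k)`, with `L` the bound on the subgradients. -/
def reachable (N : SubgradientNetwork m n W) (L M : ℝ) (k : ℕ) : Set (AgentState m n) :=
  {x | ∀ i h, ‖x i - x h‖ ≤
    2 * m * (⨆ j, ‖N.x₀ j‖) + 2 * m * (L + M) * ∑ r ∈ Finset.range k, N.α r}

end SubgradientNetwork

/-- The product `A(k) A(k-1) ⋯ A(s)`, for `s ≤ k`. -/
noncomputable def backwardProduct {m : ℕ} (A : ℕ → Matrix (Fin m) (Fin m) ℝ) (k s : ℕ) :
    Matrix (Fin m) (Fin m) ℝ :=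
  ((List.range' s (k + 1 - s)).reverse.map A).prod

/-- The product `A(s) A(s+1) ⋯ A(k)`, for `s ≤ k`. -/
noncomputable def forwardProduct {m : ℕ} (A : ℕ → Matrix (Fin m) (Fin m) ℝ) (k s : ℕ) :
    Matrix (Fin m) (Fin m) ℝ :=
  ((List.range' s (k + 1 - s)).map A).prod

/-- `max_{i,j} |Φ_ij - 1/m|`. -/
noncomputable def disagreement {m : ℕ} (Φ : Matrix (Fin m) (Fin m) ℝ) : ℝ :=
  ⨆ p : Fin m × Fin m, |Φ p.1 p.2 - 1 / (m : ℝ)|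

/-!
The deviation `V(z) = ∑ᵢ (zᵢ - z̄)²` is a Lyapunov function for consensus: multiplying `z` by a
doubly stochastic matrix with diagonal entries at least `γ` decreases `V` by at least `γ/2` times
the Dirichlet form of the matrix. If the entries on the edges of a strongly connected graph have
conditional expectation at least `q`, a Poincaré inequality turns this into a conditional
contraction of `V` by a factor `exp (-κ q)`, for products taken in either order.

By Markov's inequality `q` can be `γ` times the probability of communication. The stepsizes keep the
differences between agents at time `t` within `O(log^{1/(2C)} t)`, so that this probability is at
least a multiple of `1 / √(log (t + 3))`. The total decay over `[s, k]` is therefore at least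
`a (k - s) / √(log (k + 3))`, and AM-GM with `log (k + 3) ≤ log (s + 3) + log (k - s + 1)` bounds
this from below by `√(k - s) - √(log (s + 3)) / a - const`. The exponential of `√(log (s + 3)) / a`
is the subpolynomial `β(s)`.
-/

section Consensus

variable {ι : Type*} [Fintype ι]

/-- The sum of the squared distances of the coordinates of `z` from their mean: the Lyapunov
function of the averaging dynamics. -/
noncomputable def sqDeviation (z : ι → ℝ) : ℝ :=
  ∑ i, (z i - (∑ j, z j) / Fintype.card ι) ^ 2

/-- The Dirichlet form of the weights `b`, summed over ordered pairs (there is no factor `1 / 2`);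
it measures how much one averaging step with weights `b` decreases `sqDeviation`. -/
def dirichletForm (b : ι → ι → ℝ) (z : ι → ℝ) : ℝ :=
  ∑ i, ∑ j, b i j * (z i - z j) ^ 2

open Classical in
/-- The Dirichlet form of the graph with edge relation `E`, with unit weights. -/
noncomputable def edgeEnergy (E : ι → ι → Prop) : (ι → ℝ) → ℝ :=
  dirichletForm fun i j => if E i j then 1 else 0

lemma sqDeviation_nonneg (z : ι → ℝ) : 0 ≤ sqDeviation z :=
  Finset.sum_nonneg fun _ _ => sq_nonneg _

lemma sqDeviation_le_sum_sq (z : ι → ℝ) : sqDeviation z ≤ ∑ i, z i ^ 2 := by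
  set c := (∑ j, z j) / Fintype.card ι with hc
  have hsum : ∑ j, z j = Fintype.card ι * c := by
    rcases isEmpty_or_nonempty ι with _ | _
    · simp
    · rw [hc]; field_simp
  have hV : sqDeviation z = ∑ i, z i ^ 2 - Fintype.card ι * c ^ 2 := by
    have hsq (i : ι) : (z i - c) ^ 2 = z i ^ 2 - 2 * c * z i + c ^ 2 := by ring
    change ∑ i, (z i - c) ^ 2 = _
    simp only [hsq, Finset.sum_add_distrib, Finset.sum_sub_distrib,
      ← Finset.mul_sum, hsum, Finset.sum_const, Finset.card_univ, nsmul_eq_mul]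
    ring
  rw [hV]
  exact sub_le_self _ (by positivity)

lemma sqDeviation_le_sum_sq_sub (z : ι → ℝ) : sqDeviation z ≤ ∑ i, ∑ j, (z i - z j) ^ 2 := by
  refine Finset.sum_le_sum fun i _ => ?_
  have hcard : (1 : ℝ) ≤ Fintype.card ι := by exact_mod_cast Fintype.card_pos_iff.mpr ⟨i⟩
  have hmean : z i - (∑ j, z j) / Fintype.card ι = (∑ j, (z i - z j)) / Fintype.card ι := by
    simp only [Finset.sum_sub_distrib, Finset.sum_const, Finset.card_univ, nsmul_eq_mul]
    field_simp
  rw [hmean, div_pow, div_le_iff₀ (by positivity)]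
  calc (∑ j, (z i - z j)) ^ 2 ≤ Fintype.card ι * ∑ j, (z i - z j) ^ 2 :=
        sq_sum_le_card_mul_sum_sq
    _ ≤ (∑ j, (z i - z j) ^ 2) * (Fintype.card ι : ℝ) ^ 2 := by
        rw [mul_comm]
        gcongr
        exact le_self_pow₀ hcard two_ne_zero

lemma dirichletForm_swap (b : ι → ι → ℝ) (z : ι → ℝ) :
    dirichletForm (fun i j => b j i) z = dirichletForm b z := by
  rw [dirichletForm, dirichletForm, Finset.sum_comm]
  simp only [sub_sq_comm]

lemma edgeEnergy_swap (E : ι → ι → Prop) (z : ι → ℝ) :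
    edgeEnergy (fun i j => E j i) z = edgeEnergy E z :=
  dirichletForm_swap _ z

lemma mul_edgeEnergy_le_dirichletForm {E : ι → ι → Prop} {b : ι → ι → ℝ} {q : ℝ}
    (hb : ∀ i j, 0 ≤ b i j) (hq : ∀ i j, E i j → q ≤ b i j) (z : ι → ℝ) :
    q * edgeEnergy E z ≤ dirichletForm b z := by
  simp only [edgeEnergy, dirichletForm, Finset.mul_sum, ← mul_assoc]
  gcongr with i _ j
  split_ifs with h
  · simpa using hq i j h
  · simpa using hb i j

lemma sq_sub_le_edgeEnergy {E : ι → ι → Prop} {i j : ι} (h : E i j) (z : ι → ℝ) :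
    (z i - z j) ^ 2 ≤ edgeEnergy E z := by
  classical
  have hterm (k l : ι) : 0 ≤ (if E k l then (1 : ℝ) else 0) * (z k - z l) ^ 2 := by positivity
  calc (z i - z j) ^ 2 = (if E i j then 1 else 0) * (z i - z j) ^ 2 := by rw [if_pos h, one_mul]
    _ ≤ ∑ l, (if E i l then 1 else 0) * (z i - z l) ^ 2 :=
      Finset.single_le_sum (f := fun l => (if E i l then (1 : ℝ) else 0) * (z i - z l) ^ 2)
        (fun l _ => hterm i l) (Finset.mem_univ j)
    _ ≤ ∑ k, ∑ l, (if E k l then 1 else 0) * (z k - z l) ^ 2 :=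
      Finset.single_le_sum
        (f := fun k => ∑ l, (if E k l then (1 : ℝ) else 0) * (z k - z l) ^ 2)
        (fun k _ => Finset.sum_nonneg fun l _ => hterm k l) (Finset.mem_univ i)
    _ = edgeEnergy E z := rfl

lemma exists_sq_sub_le_mul_edgeEnergy {E : ι → ι → Prop} {i j : ι}
    (h : Relation.ReflTransGen E i j) :
    ∃ c, ∀ z : ι → ℝ, (z i - z j) ^ 2 ≤ c * edgeEnergy E z := by
  induction h with
  | refl => exact ⟨0, fun z => by simp⟩
  | @tail j k _ hjk ih =>
    obtain ⟨c, hc⟩ := ih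
    refine ⟨2 * (c + 1), fun z => ?_⟩
    calc (z i - z k) ^ 2 = ((z i - z j) + (z j - z k)) ^ 2 := by ring
      _ ≤ 2 * ((z i - z j) ^ 2 + (z j - z k) ^ 2) := add_sq_le
      _ ≤ 2 * (c * edgeEnergy E z + edgeEnergy E z) := by
        gcongr
        exacts [hc z, sq_sub_le_edgeEnergy hjk z]
      _ = 2 * (c + 1) * edgeEnergy E z := by ring

lemma exists_mul_sqDeviation_le_edgeEnergy {E : ι → ι → Prop}
    (hE : ∀ i j, Relation.ReflTransGen E i j) :
    ∃ c > 0, ∀ z : ι → ℝ, c * sqDeviation z ≤ edgeEnergy E z := by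
  choose c hc using fun i j => exists_sq_sub_le_mul_edgeEnergy (hE i j)
  set T : ℝ := ∑ i, ∑ j, |c i j|
  have : 0 ≤ T := by positivity
  refine ⟨(T + 1)⁻¹, by positivity, fun z => ?_⟩
  have hD : 0 ≤ edgeEnergy E z := by
    unfold edgeEnergy dirichletForm; positivity
  rw [inv_mul_le_iff₀ (by positivity)]
  calc sqDeviation z ≤ ∑ i, ∑ j, (z i - z j) ^ 2 := sqDeviation_le_sum_sq_sub z
    _ ≤ ∑ i, ∑ j, |c i j| * edgeEnergy E z := by
      gcongr with i _ j
      exact (hc i j z).trans (by gcongr; exact le_abs_self _)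
    _ = T * edgeEnergy E z := by simp only [T, Finset.sum_mul]
    _ ≤ (T + 1) * edgeEnergy E z := by gcongr; linarith

lemma sq_sum_mul_add_le {a : ι → ℝ} (ha : ∀ j, 0 ≤ a j) (hs : ∑ j, a j = 1) (z : ι → ℝ) (i : ι) :
    (∑ j, a j * z j) ^ 2 + a i / 2 * ∑ j, a j * (z i - z j) ^ 2 ≤ ∑ j, a j * z j ^ 2 := by
  have hsq (l : ι) : ∑ j, a j * (z l - z j) ^ 2
      = z l ^ 2 - 2 * z l * (∑ j, a j * z j) + ∑ j, a j * z j ^ 2 := by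
    have hterm (j : ι) : a j * (z l - z j) ^ 2
        = z l ^ 2 * a j - 2 * z l * (a j * z j) + a j * z j ^ 2 := by ring
    simp only [hterm, Finset.sum_add_distrib, Finset.sum_sub_distrib, ← Finset.mul_sum, hs,
      mul_one]
  have hvar : ∑ l, a l * ∑ j, a j * (z l - z j) ^ 2
      = 2 * (∑ j, a j * z j ^ 2 - (∑ j, a j * z j) ^ 2) := by
    have hterm (l : ι) : a l * ∑ j, a j * (z l - z j) ^ 2 =
        a l * z l ^ 2 - 2 * (a l * z l) * (∑ j, a j * z j) + a l * ∑ j, a j * z j ^ 2 := by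
      rw [hsq]; ring
    simp only [hterm, Finset.sum_add_distrib, Finset.sum_sub_distrib, ← Finset.sum_mul,
      ← Finset.mul_sum, hs]
    ring
  have hsingle : a i * ∑ j, a j * (z i - z j) ^ 2 ≤ ∑ l, a l * ∑ j, a j * (z l - z j) ^ 2 :=
    Finset.single_le_sum (f := fun l => a l * ∑ j, a j * (z l - z j) ^ 2)
      (fun l _ => mul_nonneg (ha l) <| Finset.sum_nonneg fun j _ =>
        mul_nonneg (ha j) (sq_nonneg _)) (Finset.mem_univ i)
  linarith

variable [DecidableEq ι] {A : Matrix ι ι ℝ} {γ : ℝ}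

lemma sum_sq_mulVec_add_le (hA : A ∈ doublyStochastic ℝ ι) (hγ : ∀ i, γ ≤ A i i) (z : ι → ℝ) :
    ∑ i, (A.mulVec z) i ^ 2 + γ / 2 * dirichletForm A z ≤ ∑ i, z i ^ 2 := by
  have hA₀ (i j : ι) : 0 ≤ A i j := nonneg_of_mem_doublyStochastic hA
  have hrow (i : ι) : (A.mulVec z) i ^ 2 + γ / 2 * ∑ j, A i j * (z i - z j) ^ 2
      ≤ ∑ j, A i j * z j ^ 2 := by
    refine le_trans ?_ (sq_sum_mul_add_le (hA₀ i) (sum_row_of_mem_doublyStochastic hA i) z i)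
    have hvar : 0 ≤ ∑ j, A i j * (z i - z j) ^ 2 :=
      Finset.sum_nonneg fun j _ => mul_nonneg (hA₀ i j) (sq_nonneg _)
    exact add_le_add le_rfl (by gcongr; exact hγ i)
  calc ∑ i, (A.mulVec z) i ^ 2 + γ / 2 * dirichletForm A z
      = ∑ i, ((A.mulVec z) i ^ 2 + γ / 2 * ∑ j, A i j * (z i - z j) ^ 2) := by
        simp only [dirichletForm, Finset.mul_sum, Finset.sum_add_distrib]
    _ ≤ ∑ i, ∑ j, A i j * z j ^ 2 := Finset.sum_le_sum fun i _ => hrow i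
    _ = ∑ j, z j ^ 2 := by
      rw [Finset.sum_comm]
      simp only [← Finset.sum_mul, sum_col_of_mem_doublyStochastic hA, one_mul]

lemma sqDeviation_mulVec_add_le (hA : A ∈ doublyStochastic ℝ ι) (hγ : ∀ i, γ ≤ A i i)
    (z : ι → ℝ) :
    sqDeviation (A.mulVec z) + γ / 2 * dirichletForm A z ≤ sqDeviation z := by
  set c := (∑ j, z j) / Fintype.card ι with hc
  have hcentered (i : ι) : A.mulVec (fun j => z j - c) i = A.mulVec z i - c := by
    simp only [Matrix.mulVec, dotProduct, mul_sub, Finset.sum_sub_distrib, ← Finset.sum_mul,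
      sum_row_of_mem_doublyStochastic hA, one_mul]
  have hmean : ∑ i, A.mulVec z i = ∑ i, z i := sum_mulVec_of_mem_doublyStochastic hA
  simpa only [hcentered, sqDeviation, dirichletForm, hmean, ← hc, sub_sub_sub_cancel_right] using
    sum_sq_mulVec_add_le hA hγ fun j => z j - c

end Consensus

section MatrixProducts

open Matrix

lemma measurable_matrix_mul {Ω ι κ ν : Type*} [MeasurableSpace Ω] [Fintype κ]
    {A : Ω → Matrix ι κ ℝ} {B : Ω → Matrix κ ν ℝ} (hA : ∀ i j, Measurable fun ω => A ω i j)
    (hB : ∀ i j, Measurable fun ω => B ω i j) (i : ι) (j : ν) :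
    Measurable fun ω => (A ω * B ω) i j := by
  simp only [Matrix.mul_apply]
  fun_prop

variable {m : ℕ}

lemma backwardProduct_self (A : ℕ → Matrix (Fin m) (Fin m) ℝ) (s : ℕ) :
    backwardProduct A s s = A s := by
  simp [backwardProduct]

lemma backwardProduct_succ (A : ℕ → Matrix (Fin m) (Fin m) ℝ) {k s : ℕ} (hsk : s ≤ k) :
    backwardProduct A (k + 1) s = A (k + 1) * backwardProduct A k s := by
  rw [backwardProduct, Nat.sub_add_comm (by lia), List.range'_concat]
  simp [backwardProduct, show s + (k + 1 - s) = k + 1 by lia]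

lemma forwardProduct_eq_transpose (A : ℕ → Matrix (Fin m) (Fin m) ℝ) (k s : ℕ) :
    forwardProduct A k s = (backwardProduct (fun t => (A t)ᵀ) k s)ᵀ := by
  rw [backwardProduct, forwardProduct, transpose_list_prod, List.map_map, ← List.map_reverse,
    List.reverse_reverse]
  rfl

lemma backwardProduct_mem_doublyStochastic {A : ℕ → Matrix (Fin m) (Fin m) ℝ} {k s : ℕ}
    (hsk : s ≤ k) (hA : ∀ t, s ≤ t → A t ∈ doublyStochastic ℝ (Fin m)) :
    backwardProduct A k s ∈ doublyStochastic ℝ (Fin m) := by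
  induction k, hsk using Nat.le_induction with
  | base => rw [backwardProduct_self]; exact hA s le_rfl
  | succ k hsk ih => rw [backwardProduct_succ A hsk]; exact mul_mem (hA _ (by lia)) ih

lemma measurable_backwardProduct {Ω : Type*} {mΩ : MeasurableSpace Ω}
    {A : Ω → ℕ → Matrix (Fin m) (Fin m) ℝ} {k s : ℕ} (hsk : s ≤ k)
    (hA : ∀ t ≤ k, ∀ i j, Measurable fun ω => A ω t i j) :
    ∀ i j, Measurable fun ω => backwardProduct (A ω) k s i j := by
  induction k, hsk using Nat.le_induction with
  | base => simpa only [backwardProduct_self] using hA s le_rfl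
  | succ k hsk ih =>
    simp only [backwardProduct_succ _ hsk]
    exact measurable_matrix_mul (hA _ le_rfl) (ih fun t ht => hA t (by lia))

lemma disagreement_nonneg (Q : Matrix (Fin m) (Fin m) ℝ) : 0 ≤ disagreement Q :=
  Real.iSup_nonneg fun _ => abs_nonneg _

lemma disagreement_transpose (Q : Matrix (Fin m) (Fin m) ℝ) :
    disagreement Qᵀ = disagreement Q :=
  (Equiv.prodComm (Fin m) (Fin m)).iSup_congr fun _ => rfl

lemma measurable_disagreement {Ω : Type*} [MeasurableSpace Ω]
    {Q : Ω → Matrix (Fin m) (Fin m) ℝ} (hQ : ∀ i j, Measurable fun ω => Q ω i j) :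
    Measurable fun ω => disagreement (Q ω) :=
  Measurable.iSup fun p => ((hQ p.1 p.2).sub_const _).abs

lemma disagreement_sq_le_sum_sqDeviation {Q : Matrix (Fin m) (Fin m) ℝ}
    (hQ : Q ∈ doublyStochastic ℝ (Fin m)) :
    disagreement Q ^ 2 ≤ ∑ l, sqDeviation (Q *ᵥ Pi.single l 1) := by
  have hcol (l : Fin m) : sqDeviation (Q *ᵥ Pi.single l 1) = ∑ i, (Q i l - 1 / (m : ℝ)) ^ 2 := by
    simp only [sqDeviation, mulVec_single_one, col_apply, sum_col_of_mem_doublyStochastic hQ,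
      Fintype.card_fin]
  have hV : 0 ≤ ∑ l, sqDeviation (Q *ᵥ Pi.single l 1) :=
    Finset.sum_nonneg fun l _ => sqDeviation_nonneg _
  have hentry (i l : Fin m) :
      (Q i l - 1 / (m : ℝ)) ^ 2 ≤ ∑ l, sqDeviation (Q *ᵥ Pi.single l 1) :=
    calc (Q i l - 1 / (m : ℝ)) ^ 2 ≤ sqDeviation (Q *ᵥ Pi.single l 1) := by
          rw [hcol]
          exact Finset.single_le_sum (f := fun i => (Q i l - 1 / (m : ℝ)) ^ 2)
            (fun _ _ => sq_nonneg _) (Finset.mem_univ i)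
      _ ≤ _ := Finset.single_le_sum (f := fun l => sqDeviation (Q *ᵥ Pi.single l 1))
          (fun l _ => sqDeviation_nonneg _) (Finset.mem_univ l)
  calc disagreement Q ^ 2 ≤ √(∑ l, sqDeviation (Q *ᵥ Pi.single l 1)) ^ 2 := by
        gcongr
        · exact disagreement_nonneg Q
        · exact Real.iSup_le (fun p => Real.abs_le_sqrt (hentry p.1 p.2)) (Real.sqrt_nonneg _)
    _ = _ := Real.sq_sqrt hV

lemma sqDeviation_mulVec_le {ι : Type*} [Fintype ι] [DecidableEq ι] {Q : Matrix ι ι ℝ}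
    (hQ : Q ∈ doublyStochastic ℝ ι) (z : ι → ℝ) : sqDeviation (Q *ᵥ z) ≤ sqDeviation z := by
  simpa using sqDeviation_mulVec_add_le hQ (fun i => nonneg_of_mem_doublyStochastic hQ) z

lemma sum_sqDeviation_single_le (m : ℕ) :
    ∑ l : Fin m, sqDeviation (Pi.single l 1 : Fin m → ℝ) ≤ m := by
  refine (Finset.sum_le_sum fun l _ => sqDeviation_le_sum_sq _).trans_eq ?_
  simp [Pi.single_apply]

lemma measurable_mulVec_apply {Ω ι κ : Type*} {mΩ : MeasurableSpace Ω} [Fintype κ]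
    {A : Ω → Matrix ι κ ℝ} {z : Ω → κ → ℝ} (hA : ∀ i j, Measurable fun ω => A ω i j)
    (hz : ∀ j, Measurable fun ω => z ω j) (i : ι) : Measurable fun ω => (A ω *ᵥ z ω) i := by
  simp only [mulVec, dotProduct]
  fun_prop

lemma measurable_sqDeviation {Ω ι : Type*} {mΩ : MeasurableSpace Ω} [Fintype ι] {z : Ω → ι → ℝ}
    (hz : ∀ i, Measurable fun ω => z ω i) : Measurable fun ω => sqDeviation (z ω) := by
  unfold sqDeviation
  fun_prop

lemma abs_mulVec_apply_le_sum_abs {ι : Type*} [Fintype ι] [DecidableEq ι] {Q : Matrix ι ι ℝ}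
    (hQ : Q ∈ doublyStochastic ℝ ι) (z : ι → ℝ) (i : ι) : |(Q *ᵥ z) i| ≤ ∑ j, |z j| := by
  refine (Finset.abs_sum_le_sum_abs _ _).trans (Finset.sum_le_sum fun j _ => ?_)
  rw [abs_mul, abs_of_nonneg (nonneg_of_mem_doublyStochastic hQ)]
  exact mul_le_of_le_one_left (abs_nonneg _) (le_one_of_mem_doublyStochastic hQ)

end MatrixProducts

section RandomAveraging

open Matrix

variable {Ω : Type*} {𝓖 mΩ : MeasurableSpace Ω} {μ : Measure Ω}

lemma condExp_le_of_condExp_sq_le [IsFiniteMeasure μ] (h𝓖 : 𝓖 ≤ mΩ)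
    {f : Ω → ℝ} {θ : ℝ} (hθ : 0 < θ) (hf : MemLp f 2 μ)
    (hsq : ∀ᵐ ω ∂μ, (μ[fun ω => f ω ^ 2 | 𝓖]) ω ≤ θ ^ 2) :
    ∀ᵐ ω ∂μ, (μ[f | 𝓖]) ω ≤ θ := by
  have hf₂ : Integrable ((2 * θ)⁻¹ • fun ω => f ω ^ 2) μ := hf.integrable_sq.smul _
  have hamgm : f ≤ᵐ[μ] (fun _ => θ / 2) + (2 * θ)⁻¹ • fun ω => f ω ^ 2 := by
    refine ae_of_all _ fun ω => ?_
    have h : θ / 2 + (2 * θ)⁻¹ * f ω ^ 2 - f ω = (2 * θ)⁻¹ * (f ω - θ) ^ 2 := by field_simp; ring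
    have h₀ : 0 ≤ (2 * θ)⁻¹ * (f ω - θ) ^ 2 := by positivity
    simp only [Pi.add_apply, Pi.smul_apply, smul_eq_mul]
    linarith
  have hmono := condExp_mono (m := 𝓖) (hf.integrable one_le_two)
    ((integrable_const (θ / 2)).add hf₂) hamgm
  filter_upwards [hmono, condExp_add (integrable_const (θ / 2)) hf₂ 𝓖,
    condExp_smul (2 * θ)⁻¹ (fun ω => f ω ^ 2) 𝓖 (μ := μ), hsq] with ω hle hadd hsmul hsqω
  rw [hadd, Pi.add_apply, hsmul, condExp_const h𝓖, Pi.smul_apply, smul_eq_mul] at hle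
  calc (μ[f | 𝓖]) ω ≤ θ / 2 + (2 * θ)⁻¹ * (μ[fun ω => f ω ^ 2 | 𝓖]) ω := hle
    _ ≤ θ / 2 + (2 * θ)⁻¹ * θ ^ 2 := by gcongr
    _ = θ := by field_simp; ring

section OneStep

variable {ι : Type*} [Fintype ι] {A : Ω → Matrix ι ι ℝ} {z : Ω → ι → ℝ}

lemma integrable_sqDeviation (hz : ∀ i, MemLp (fun ω => z ω i) 2 μ) :
    Integrable (fun ω => sqDeviation (z ω)) μ := by
  refine (integrable_finsetSum Finset.univ fun i _ => (hz i).integrable_sq).mono' ?_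
    (ae_of_all _ fun ω => ?_)
  · exact ((measurable_sqDeviation measurable_pi_apply).comp_aemeasurable
      (aemeasurable_pi_lambda z fun i => (hz i).1.aemeasurable)).aestronglyMeasurable
  · rw [Real.norm_of_nonneg (sqDeviation_nonneg _)]
    exact sqDeviation_le_sum_sq _

variable [DecidableEq ι]

lemma integrable_of_ae_doublyStochastic [IsFiniteMeasure μ]
    (hA : ∀ i j, Measurable fun ω => A ω i j)
    (hds : ∀ᵐ ω ∂μ, A ω ∈ doublyStochastic ℝ ι) (i j : ι) : Integrable (fun ω => A ω i j) μ := by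
  refine .of_bound (hA i j).aestronglyMeasurable 1 ?_
  filter_upwards [hds] with ω hω
  rw [Real.norm_of_nonneg (nonneg_of_mem_doublyStochastic hω)]
  exact le_one_of_mem_doublyStochastic hω

lemma integrable_mul_sq_sub (hA : ∀ i j, Measurable fun ω => A ω i j)
    (hds : ∀ᵐ ω ∂μ, A ω ∈ doublyStochastic ℝ ι) (hz : ∀ i, MemLp (fun ω => z ω i) 2 μ)
    (i j : ι) : Integrable (fun ω => A ω i j * (z ω i - z ω j) ^ 2) μ := by
  refine ((hz i).sub (hz j)).integrable_sq.bdd_mul (c := 1) (hA i j).aestronglyMeasurable ?_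
  filter_upwards [hds] with ω hω
  rw [Real.norm_of_nonneg (nonneg_of_mem_doublyStochastic hω)]
  exact le_one_of_mem_doublyStochastic hω

lemma condExp_dirichletForm [IsFiniteMeasure μ]
    (hA : ∀ i j, Measurable fun ω => A ω i j) (hds : ∀ᵐ ω ∂μ, A ω ∈ doublyStochastic ℝ ι)
    (hz : ∀ i, MemLp (fun ω => z ω i) 2 μ) (hz𝓖 : ∀ i, Measurable[𝓖] fun ω => z ω i) :
    μ[fun ω => dirichletForm (A ω) (z ω) | 𝓖]
      =ᵐ[μ] fun ω => dirichletForm (fun i j => (μ[fun ω => A ω i j | 𝓖]) ω) (z ω) := by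
  have hint := integrable_mul_sq_sub hA hds hz
  have hsum : (fun ω => dirichletForm (A ω) (z ω))
      = ∑ i, ∑ j, fun ω => A ω i j * (z ω i - z ω j) ^ 2 := by
    ext ω; simp only [dirichletForm, Finset.sum_apply]
  have hterm (i j : ι) : μ[fun ω => A ω i j * (z ω i - z ω j) ^ 2 | 𝓖]
      =ᵐ[μ] fun ω => (μ[fun ω => A ω i j | 𝓖]) ω * (z ω i - z ω j) ^ 2 :=
    condExp_mul_of_stronglyMeasurable_right
      (((hz𝓖 i).sub (hz𝓖 j)).pow_const 2).stronglyMeasurable (hint i j)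
      (integrable_of_ae_doublyStochastic hA hds i j)
  have hrow (i : ι) := condExp_finsetSum (s := Finset.univ) (fun j _ => hint i j) 𝓖
  rw [hsum]
  filter_upwards [condExp_finsetSum (s := Finset.univ)
    (fun i _ => integrable_finsetSum' Finset.univ fun j _ => hint i j) 𝓖,
    ae_all_iff.mpr hrow, ae_all_iff.mpr fun i => ae_all_iff.mpr (hterm i)] with
    ω hsumω hrowω htermω
  simp only [hsumω, Finset.sum_apply, hrowω, htermω, dirichletForm]

lemma integrable_sqDeviation_mulVec (hA : ∀ i j, Measurable fun ω => A ω i j)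
    (hds : ∀ᵐ ω ∂μ, A ω ∈ doublyStochastic ℝ ι) (hz : ∀ i, MemLp (fun ω => z ω i) 2 μ) :
    Integrable (fun ω => sqDeviation (A ω *ᵥ z ω)) μ := by
  have hmeas : AEMeasurable (fun ω => A ω *ᵥ z ω) μ :=
    aemeasurable_pi_lambda _ fun i => by
      simp only [mulVec, dotProduct]
      exact Finset.aemeasurable_fun_sum _ fun j _ => (hA i j).aemeasurable.mul (hz j).1.aemeasurable
  refine (integrable_sqDeviation hz).mono'
    ((measurable_sqDeviation measurable_pi_apply).comp_aemeasurable hmeas).aestronglyMeasurable ?_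
  filter_upwards [hds] with ω hω
  rw [Real.norm_of_nonneg (sqDeviation_nonneg _)]
  exact sqDeviation_mulVec_le hω _

lemma condExp_sqDeviation_mulVec_le [IsFiniteMeasure μ] (h𝓖 : 𝓖 ≤ mΩ)
    {E : ι → ι → Prop} {c γ q : ℝ} (hγ : 0 ≤ γ) (hq : 0 ≤ q)
    (hE : ∀ z : ι → ℝ, c * sqDeviation z ≤ edgeEnergy E z)
    (hA : ∀ i j, Measurable fun ω => A ω i j) (hds : ∀ᵐ ω ∂μ, A ω ∈ doublyStochastic ℝ ι)
    (hself : ∀ᵐ ω ∂μ, ∀ i, γ ≤ A ω i i)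
    (hqA : ∀ i j, E i j → ∀ᵐ ω ∂μ, q ≤ (μ[fun ω => A ω i j | 𝓖]) ω)
    (hz : ∀ i, MemLp (fun ω => z ω i) 2 μ) (hz𝓖 : ∀ i, Measurable[𝓖] fun ω => z ω i) :
    ∀ᵐ ω ∂μ, (μ[fun ω => sqDeviation (A ω *ᵥ z ω) | 𝓖]) ω
      ≤ Real.exp (-(γ * c / 2 * q)) * sqDeviation (z ω) := by
  have hVz := integrable_sqDeviation hz
  have hV𝓖 : StronglyMeasurable[𝓖] fun ω => sqDeviation (z ω) :=
    (measurable_sqDeviation hz𝓖).stronglyMeasurable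
  have hD : Integrable (fun ω => dirichletForm (A ω) (z ω)) μ :=
    integrable_finsetSum _ fun i _ => integrable_finsetSum _ fun j _ =>
      integrable_mul_sq_sub hA hds hz i j
  have hVA := integrable_sqDeviation_mulVec hA hds hz
  have hmono : μ[fun ω => sqDeviation (A ω *ᵥ z ω) | 𝓖] ≤ᵐ[μ]
      μ[(fun ω => sqDeviation (z ω)) - (γ / 2) • fun ω => dirichletForm (A ω) (z ω) | 𝓖] := by
    refine condExp_mono hVA (hVz.sub (hD.smul _)) ?_
    filter_upwards [hds, hself] with ω hdsω hselfω
    exact le_sub_iff_add_le.mpr (sqDeviation_mulVec_add_le hdsω hselfω _)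
  have hnonneg : ∀ᵐ ω ∂μ, ∀ i j, 0 ≤ (μ[fun ω => A ω i j | 𝓖]) ω :=
    ae_all_iff.mpr fun i => ae_all_iff.mpr fun j => condExp_nonneg <| by
      filter_upwards [hds] with ω hω using nonneg_of_mem_doublyStochastic hω
  have hedge : ∀ᵐ ω ∂μ, ∀ i j, E i j → q ≤ (μ[fun ω => A ω i j | 𝓖]) ω := by
    simpa only [ae_all_iff] using hqA
  filter_upwards [hmono, condExp_sub hVz (hD.smul (γ / 2)) 𝓖,
    condExp_smul (γ / 2) (fun ω => dirichletForm (A ω) (z ω)) 𝓖 (μ := μ),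
    condExp_dirichletForm hA hds hz hz𝓖, hnonneg, hedge] with ω hle hsub hsmul hform hnonnegω hedgeω
  rw [hsub, Pi.sub_apply, hsmul, Pi.smul_apply, hform,
    condExp_of_stronglyMeasurable h𝓖 hV𝓖 hVz] at hle
  calc (μ[fun ω => sqDeviation (A ω *ᵥ z ω) | 𝓖]) ω
      ≤ sqDeviation (z ω)
        - γ / 2 * dirichletForm (fun i j => (μ[fun ω => A ω i j | 𝓖]) ω) (z ω) := hle
    _ ≤ sqDeviation (z ω) - γ / 2 * (q * (c * sqDeviation (z ω))) := by
      gcongr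
      exact (mul_le_mul_of_nonneg_left (hE _) hq).trans
        (mul_edgeEnergy_le_dirichletForm hnonnegω hedgeω _)
    _ = (1 - γ * c / 2 * q) * sqDeviation (z ω) := by ring
    _ ≤ Real.exp (-(γ * c / 2 * q)) * sqDeviation (z ω) := by
      gcongr
      exacts [sqDeviation_nonneg _, Real.one_sub_le_exp_neg _]

end OneStep

/-- The random matrices `A ω t`, `t ≥ s`, are doubly stochastic with diagonal at least `γ`, they
are adapted to `ℱ` with a delay (the matrix of time `t` is revealed at time `t + 1`), and given
the past of time `t` the expected weight on each edge of `E` is at least `q t`. -/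
structure IsAveragingProcess {ι : Type*} [Fintype ι] [DecidableEq ι] (μ : Measure Ω)
    (ℱ : Filtration ℕ mΩ) (E : ι → ι → Prop) (γ : ℝ) (q : ℕ → ℝ) (s : ℕ)
    (A : Ω → ℕ → Matrix ι ι ℝ) : Prop where
  measurable : ∀ t i j, Measurable[ℱ (t + 1)] fun ω => A ω t i j
  ae_doublyStochastic : ∀ᵐ ω ∂μ, ∀ t, s ≤ t → A ω t ∈ doublyStochastic ℝ ι
  ae_le_diag : ∀ᵐ ω ∂μ, ∀ t, s ≤ t → ∀ i, γ ≤ A ω t i i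
  le_condExp : ∀ t, s ≤ t → ∀ i j, E i j → ∀ᵐ ω ∂μ, q t ≤ (μ[fun ω => A ω t i j | ℱ t]) ω

namespace IsAveragingProcess

variable {m : ℕ} {ℱ : Filtration ℕ mΩ} {E : Fin m → Fin m → Prop} {c γ : ℝ} {q : ℕ → ℝ} {s : ℕ}
  {A : Ω → ℕ → Matrix (Fin m) (Fin m) ℝ}

lemma mono (h : IsAveragingProcess μ ℱ E γ q s A) {s' : ℕ} (hs : s ≤ s') :
    IsAveragingProcess μ ℱ E γ q s' A where
  measurable := h.measurable
  ae_doublyStochastic := h.ae_doublyStochastic.mono fun _ hω t ht => hω t (hs.trans ht)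
  ae_le_diag := h.ae_le_diag.mono fun _ hω t ht => hω t (hs.trans ht)
  le_condExp t ht := h.le_condExp t (hs.trans ht)

lemma transpose (h : IsAveragingProcess μ ℱ E γ q s A) :
    IsAveragingProcess μ ℱ (fun i j => E j i) γ q s fun ω t => (A ω t)ᵀ where
  measurable t i j := h.measurable t j i
  ae_doublyStochastic := by
    simpa only [transpose_mem_doublyStochastic_iff] using h.ae_doublyStochastic
  ae_le_diag := h.ae_le_diag
  le_condExp t ht i j := h.le_condExp t ht j i

lemma measurable_apply (h : IsAveragingProcess μ ℱ E γ q s A) (t : ℕ) (i j : Fin m) :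
    Measurable fun ω => A ω t i j :=
  (h.measurable t i j).mono (ℱ.le _) le_rfl

lemma ae_backwardProduct_mem (h : IsAveragingProcess μ ℱ E γ q s A) {k : ℕ} (hsk : s ≤ k) :
    ∀ᵐ ω ∂μ, backwardProduct (A ω) k s ∈ doublyStochastic ℝ (Fin m) := by
  filter_upwards [h.ae_doublyStochastic] with ω hω using backwardProduct_mem_doublyStochastic hsk hω

lemma measurable_disagreement_backwardProduct (h : IsAveragingProcess μ ℱ E γ q s A) {k : ℕ}
    (hsk : s ≤ k) : Measurable fun ω => disagreement (backwardProduct (A ω) k s) :=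
  measurable_disagreement (measurable_backwardProduct hsk fun t _ => h.measurable_apply t)

lemma measurable_backwardProduct_mulVec (h : IsAveragingProcess μ ℱ E γ q s A) {k : ℕ}
    (hsk : s ≤ k) (z : Fin m → ℝ) (i : Fin m) :
    Measurable[ℱ (k + 1)] fun ω => (backwardProduct (A ω) k s *ᵥ z) i :=
  measurable_mulVec_apply (z := fun _ => z) (measurable_backwardProduct hsk fun t ht i j =>
    (h.measurable t i j).mono (ℱ.mono (Nat.succ_le_succ ht)) le_rfl) (fun _ => measurable_const) i

variable [IsFiniteMeasure μ]

lemma condExp_sqDeviation_mulVec_le (h : IsAveragingProcess μ ℱ E γ q s A) (hγ : 0 ≤ γ)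
    (hq : ∀ t, 0 ≤ q t) (hE : ∀ z : Fin m → ℝ, c * sqDeviation z ≤ edgeEnergy E z) {t : ℕ}
    (ht : s ≤ t) {z : Ω → Fin m → ℝ} (hz : ∀ i, MemLp (fun ω => z ω i) 2 μ)
    (hzt : ∀ i, Measurable[ℱ t] fun ω => z ω i) :
    ∀ᵐ ω ∂μ, (μ[fun ω => sqDeviation (A ω t *ᵥ z ω) | ℱ t]) ω
      ≤ Real.exp (-(γ * c / 2 * q t)) * sqDeviation (z ω) :=
  _root_.condExp_sqDeviation_mulVec_le (ℱ.le t) hγ (hq t) hE (h.measurable_apply t)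
    (h.ae_doublyStochastic.mono fun _ hω => hω t ht) (h.ae_le_diag.mono fun _ hω => hω t ht)
    (h.le_condExp t ht) hz hzt

lemma memLp_backwardProduct_mulVec (h : IsAveragingProcess μ ℱ E γ q s A) {k : ℕ}
    (hsk : s ≤ k) (z : Fin m → ℝ) (i : Fin m) :
    MemLp (fun ω => (backwardProduct (A ω) k s *ᵥ z) i) 2 μ := by
  refine .of_bound ((h.measurable_backwardProduct_mulVec hsk z i).mono (ℱ.le _)
    le_rfl).aestronglyMeasurable (∑ j, |z j|) ?_
  filter_upwards [h.ae_backwardProduct_mem hsk] with ω hω using abs_mulVec_apply_le_sum_abs hω z i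

lemma condExp_sqDeviation_backwardProduct_le (h : IsAveragingProcess μ ℱ E γ q s A) (hγ : 0 ≤ γ)
    (hq : ∀ t, 0 ≤ q t) (hE : ∀ z : Fin m → ℝ, c * sqDeviation z ≤ edgeEnergy E z) {k : ℕ}
    (hsk : s ≤ k) (z : Fin m → ℝ) :
    ∀ᵐ ω ∂μ, (μ[fun ω => sqDeviation (backwardProduct (A ω) k s *ᵥ z) | ℱ s]) ω
      ≤ Real.exp (-(γ * c / 2 * ∑ t ∈ Finset.Icc s k, q t)) * sqDeviation z := by
  induction k, hsk using Nat.le_induction with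
  | base =>
    simpa only [backwardProduct_self, Finset.Icc_self, Finset.sum_singleton] using
      h.condExp_sqDeviation_mulVec_le hγ hq hE le_rfl (fun i => memLp_const (z i))
        fun i => measurable_const
  | succ k hsk ih =>
    set V : Ω → ℝ := fun ω => sqDeviation (backwardProduct (A ω) k s *ᵥ z)
    have hV : Integrable V μ := integrable_sqDeviation (h.memLp_backwardProduct_mulVec hsk z)
    set r := Real.exp (-(γ * c / 2 * q (k + 1))) with hr
    have htower := condExp_condExp_of_le (μ := μ) (ℱ.mono (show s ≤ k + 1 by lia)) (ℱ.le _)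
      (f := fun ω => sqDeviation (A ω (k + 1) *ᵥ (backwardProduct (A ω) k s *ᵥ z)))
    have hmono := condExp_mono (m := ℱ s) integrable_condExp (hV.smul r)
      (h.condExp_sqDeviation_mulVec_le hγ hq hE (by lia) (h.memLp_backwardProduct_mulVec hsk z)
        (h.measurable_backwardProduct_mulVec hsk z))
    simp only [backwardProduct_succ _ hsk, ← mulVec_mulVec]
    filter_upwards [htower, hmono, ih, condExp_smul r V (ℱ s) (μ := μ)] with
      ω htowerω hle ihω hsmul
    rw [htowerω, hsmul, Pi.smul_apply, smul_eq_mul] at hle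
    calc _ ≤ r * (μ[V | ℱ s]) ω := hle
      _ ≤ r * (Real.exp (-(γ * c / 2 * ∑ t ∈ Finset.Icc s k, q t)) * sqDeviation z) := by gcongr
      _ = _ := by
        rw [Finset.sum_Icc_succ_top (by lia), ← mul_assoc, hr, ← Real.exp_add]
        ring_nf

lemma memLp_disagreement_backwardProduct (h : IsAveragingProcess μ ℱ E γ q s A) {k : ℕ}
    (hsk : s ≤ k) : MemLp (fun ω => disagreement (backwardProduct (A ω) k s)) 2 μ := by
  refine .of_bound (h.measurable_disagreement_backwardProduct hsk).aestronglyMeasurable √m ?_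
  filter_upwards [h.ae_backwardProduct_mem hsk] with ω hω
  rw [Real.norm_of_nonneg (disagreement_nonneg _)]
  refine Real.le_sqrt_of_sq_le ((disagreement_sq_le_sum_sqDeviation hω).trans ?_)
  exact (Finset.sum_le_sum fun l _ => sqDeviation_mulVec_le hω _).trans
    (sum_sqDeviation_single_le m)

lemma condExp_disagreement_backwardProduct_le (hm : 0 < m)
    (h : IsAveragingProcess μ ℱ E γ q s A) (hγ : 0 ≤ γ) (hq : ∀ t, 0 ≤ q t)
    (hE : ∀ z : Fin m → ℝ, c * sqDeviation z ≤ edgeEnergy E z) {k : ℕ} (hsk : s ≤ k) :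
    ∀ᵐ ω ∂μ, (μ[fun ω => disagreement (backwardProduct (A ω) k s) | ℱ s]) ω
      ≤ √m * Real.exp (-(γ * c / 4 * ∑ t ∈ Finset.Icc s k, q t)) := by
  refine condExp_le_of_condExp_sq_le (ℱ.le s) (by positivity)
    (h.memLp_disagreement_backwardProduct hsk) ?_
  have hV (l : Fin m) :
      Integrable (fun ω => sqDeviation (backwardProduct (A ω) k s *ᵥ Pi.single l 1)) μ :=
    integrable_sqDeviation (h.memLp_backwardProduct_mulVec hsk _)
  have hmono : μ[fun ω => disagreement (backwardProduct (A ω) k s) ^ 2 | ℱ s] ≤ᵐ[μ]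
      μ[∑ l, fun ω => sqDeviation (backwardProduct (A ω) k s *ᵥ Pi.single l 1) | ℱ s] := by
    refine condExp_mono (h.memLp_disagreement_backwardProduct hsk).integrable_sq
      (integrable_finsetSum' _ fun l _ => hV l) ?_
    filter_upwards [h.ae_backwardProduct_mem hsk] with ω hω
    simpa only [Finset.sum_apply] using disagreement_sq_le_sum_sqDeviation hω
  filter_upwards [hmono, condExp_finsetSum (s := Finset.univ) (fun l _ => hV l) (ℱ s),
    ae_all_iff.mpr fun l : Fin m =>
      h.condExp_sqDeviation_backwardProduct_le hγ hq hE hsk (Pi.single l 1)] with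
    ω hle hsum hcontract
  rw [hsum, Finset.sum_apply] at hle
  calc _ ≤ ∑ l, (μ[fun ω => sqDeviation (backwardProduct (A ω) k s *ᵥ Pi.single l 1) | ℱ s]) ω :=
        hle
    _ ≤ ∑ l, Real.exp (-(γ * c / 2 * ∑ t ∈ Finset.Icc s k, q t)) * sqDeviation (Pi.single l 1) :=
      Finset.sum_le_sum fun l _ => hcontract l
    _ ≤ Real.exp (-(γ * c / 2 * ∑ t ∈ Finset.Icc s k, q t)) * m := by
      rw [← Finset.mul_sum]
      gcongr
      exact sum_sqDeviation_single_le m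
    _ = (√m * Real.exp (-(γ * c / 4 * ∑ t ∈ Finset.Icc s k, q t))) ^ 2 := by
      rw [mul_pow, Real.sq_sqrt m.cast_nonneg, ← Real.exp_nat_mul, mul_comm]
      ring_nf

lemma condExp_disagreement_le (hm : 0 < m) (h : IsAveragingProcess μ ℱ E γ q s A) (hγ : 0 ≤ γ)
    (hq : ∀ t, 0 ≤ q t) (hE : ∀ z : Fin m → ℝ, c * sqDeviation z ≤ edgeEnergy E z) {k : ℕ}
    (hsk : s ≤ k) {Φ : (ℕ → Matrix (Fin m) (Fin m) ℝ) → ℕ → ℕ → Matrix (Fin m) (Fin m) ℝ}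
    (hΦ : Φ ∈ ({backwardProduct, forwardProduct} : Set _)) :
    Integrable (fun ω => disagreement (Φ (A ω) k s)) μ ∧
      ∀ᵐ ω ∂μ, (μ[fun ω => disagreement (Φ (A ω) k s) | ℱ s]) ω
        ≤ √m * Real.exp (-(γ * c / 4 * ∑ t ∈ Finset.Icc s k, q t)) := by
  rcases hΦ with rfl | rfl
  · exact ⟨(h.memLp_disagreement_backwardProduct hsk).integrable one_le_two,
      h.condExp_disagreement_backwardProduct_le hm hγ hq hE hsk⟩
  · simp only [forwardProduct_eq_transpose, disagreement_transpose]
    exact ⟨(h.transpose.memLp_disagreement_backwardProduct hsk).integrable one_le_two,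
      h.transpose.condExp_disagreement_backwardProduct_le hm hγ hq
        (fun z => by simpa only [edgeEnergy_swap] using hE z) hsk⟩

end IsAveragingProcess

end RandomAveraging

section Noise

open ProbabilityTheory

section Freezing

variable {Ω E F : Type*} {𝓖 mΩ : MeasurableSpace Ω} [MeasurableSpace E] [mF : MeasurableSpace F]
  {μ : Measure Ω} [IsProbabilityMeasure μ] {X : Ω → E} {Y : Ω → F}

lemma map_prodMk_restrict_of_indep (h𝓖 : 𝓖 ≤ mΩ) (hX : Measurable[𝓖] X) (hY : Measurable Y)
    (hXY : Indep 𝓖 (mF.comap Y) μ) {S : Set Ω} (hS : MeasurableSet[𝓖] S) :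
    (μ.restrict S).map (fun ω => (X ω, Y ω)) = ((μ.restrict S).map X).prod (μ.map Y) := by
  have hX' := hX.mono h𝓖 le_rfl
  have := Measure.isProbabilityMeasure_map (μ := μ) hY.aemeasurable
  refine (Measure.prod_eq fun a b ha hb => ?_).symm
  rw [Measure.map_apply (hX'.prodMk hY) (ha.prod hb), Measure.map_apply hX' ha,
    Measure.map_apply hY hb, Measure.restrict_apply' (h𝓖 _ hS), Measure.restrict_apply' (h𝓖 _ hS),
    ← (Indep_iff 𝓖 _ μ).1 hXY _ _ ((hX ha).inter hS) ⟨b, hb, rfl⟩]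
  congr 1
  ext ω
  simp only [Set.mem_inter_iff, Set.mem_preimage, Set.mem_prod]
  tauto

lemma condExp_indicator_prodMk_of_indep (h𝓖 : 𝓖 ≤ mΩ) (hX : Measurable[𝓖] X)
    (hY : Measurable Y) (hXY : Indep 𝓖 (mF.comap Y) μ)
    {T : Set (E × F)} (hT : MeasurableSet T) :
    μ⟦(fun ω => (X ω, Y ω)) ⁻¹' T | 𝓖⟧ =ᵐ[μ] fun ω => (μ.map Y).real (Prod.mk (X ω) ⁻¹' T) := by
  have hX' := hX.mono h𝓖 le_rfl
  have hXY' : MeasurableSet ((fun ω => (X ω, Y ω)) ⁻¹' T) := (hX'.prodMk hY) hT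
  have := Measure.isProbabilityMeasure_map (μ := μ) hY.aemeasurable
  have hsec : Measurable[𝓖] fun ω => (μ.map Y) (Prod.mk (X ω) ⁻¹' T) :=
    (measurable_measure_prodMk_left hT).comp hX
  refine (ae_eq_condExp_of_forall_setIntegral_eq h𝓖 ((integrable_const 1).indicator hXY')
    (fun S _ _ => ?_) (fun S hS _ => ?_) hsec.ennreal_toReal.aestronglyMeasurable).symm
  · refine (Integrable.of_bound (C := 1)
      (hsec.ennreal_toReal.mono h𝓖 le_rfl).aestronglyMeasurable ?_).integrableOn
    exact ae_of_all _ fun ω => (Real.norm_of_nonneg measureReal_nonneg).trans_le measureReal_le_one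
  · rw [integral_toReal (hsec.mono h𝓖 le_rfl).aemeasurable
        (ae_of_all _ fun ω => measure_lt_top _ _),
      integral_indicator_const _ hXY', smul_eq_mul, mul_one, measureReal_def,
      ← Measure.map_apply (hX'.prodMk hY) hT,
      map_prodMk_restrict_of_indep h𝓖 hX hY hXY hS, Measure.prod_apply hT,
      lintegral_map (measurable_measure_prodMk_left hT) hX']

end Freezing

variable {W : Type*} [MeasurableSpace W]

/-- The filtration of the noise: at time `k`, the noise of the times before `k` (excluding `k`
itself) is known. -/
def pastNoise (W : Type*) [MeasurableSpace W] :
    Filtration ℕ (MeasurableSpace.pi : MeasurableSpace (ℕ → W)) where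
  seq k := cylinderEvents (Set.Iio k)
  mono' _ _ h := cylinderEvents_mono (Set.Iio_subset_Iio h)
  le' _ := cylinderEvents_le_pi

lemma measurable_prodMk_noise {E : Type*} [MeasurableSpace E] {k : ℕ} {X : (ℕ → W) → E}
    (hX : Measurable[pastNoise W k] X) : Measurable[pastNoise W (k + 1)] fun ω => (X ω, ω k) :=
  (hX.mono ((pastNoise W).mono k.le_succ) le_rfl).prodMk
    (measurable_cylinderEvent_apply (Set.mem_Iio.mpr k.lt_succ_self))

variable (P : Measure W) [IsProbabilityMeasure P]

instance isProbabilityMeasure_noiseLaw : IsProbabilityMeasure (SubgradientNetwork.noiseLaw P) := by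
  unfold SubgradientNetwork.noiseLaw; infer_instance

lemma indep_pastNoise (k : ℕ) :
    Indep (pastNoise W k) (MeasurableSpace.comap (fun ω : ℕ → W => ω k) inferInstance)
      (SubgradientNetwork.noiseLaw P) := by
  have hindep : iIndepFun (fun (i : ℕ) (ω : ℕ → W) => ω i) (SubgradientNetwork.noiseLaw P) :=
    iIndepFun_infinitePi (P := fun _ : ℕ => P) (X := fun _ ω => ω) fun _ => measurable_id
  have hpast := indep_iSup_of_disjoint (fun i => (measurable_pi_apply i).comap_le) hindep.iIndep
    (Set.disjoint_singleton_right.mpr Set.self_notMem_Iio : Disjoint (Set.Iio k) {k})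
  simp only [Set.mem_singleton_iff, iSup_iSup_eq_left] at hpast
  exact hpast

lemma condExp_indicator_noise {E : Type*} [MeasurableSpace E] {k : ℕ} {X : (ℕ → W) → E}
    (hX : Measurable[pastNoise W k] X) {T : Set (E × W)} (hT : MeasurableSet T) :
    (SubgradientNetwork.noiseLaw P)⟦(fun ω => (X ω, ω k)) ⁻¹' T | pastNoise W k⟧
      =ᵐ[SubgradientNetwork.noiseLaw P] fun ω => P.real (Prod.mk (X ω) ⁻¹' T) := by
  have hlaw : (SubgradientNetwork.noiseLaw P).map (fun ω => ω k) = P :=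
    Measure.infinitePi_map_eval (fun _ => P) k
  simpa only [hlaw] using condExp_indicator_prodMk_of_indep ((pastNoise W).le k) hX
    (measurable_pi_apply k) (indep_pastNoise P k) hT

end Noise

section Projection

variable {n : ℕ} {X : Set (EuclideanSpace ℝ (Fin n))}

lemma projOn_mem_and_isMinOn (hne : X.Nonempty) (hcl : IsClosed X)
    (x : EuclideanSpace ℝ (Fin n)) :
    projOn X x ∈ X ∧ IsMinOn (fun z => ‖x - z‖) X (projOn X x) := by
  obtain ⟨y, hy, hxy⟩ := hcl.exists_infDist_eq_dist hne x
  refine Classical.epsilon_spec (p := fun y => y ∈ X ∧ IsMinOn (fun z => ‖x - z‖) X y)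
    ⟨y, hy, fun z hz => ?_⟩
  change ‖x - y‖ ≤ ‖x - z‖
  rw [← dist_eq_norm, ← dist_eq_norm, ← hxy]
  exact Metric.infDist_le_dist_of_mem hz

lemma inner_sub_projOn_le_zero (hcl : IsClosed X) (hcv : Convex ℝ X)
    (x : EuclideanSpace ℝ (Fin n)) {z : EuclideanSpace ℝ (Fin n)} (hz : z ∈ X) :
    inner ℝ (x - projOn X x) (z - projOn X x) ≤ 0 := by
  obtain ⟨hmem, hmin⟩ := projOn_mem_and_isMinOn ⟨z, hz⟩ hcl x
  have : Nonempty X := ⟨z, hz⟩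
  refine (norm_eq_iInf_iff_real_inner_le_zero hcv hmem).1 ?_ z hz
  exact le_antisymm (le_ciInf fun w => hmin w.2)
    (ciInf_le ⟨0, Set.forall_mem_range.2 fun w : X => norm_nonneg (x - w)⟩ ⟨_, hmem⟩)

lemma norm_projOn_sub_projOn_le (hne : X.Nonempty) (hcl : IsClosed X) (hcv : Convex ℝ X)
    (x y : EuclideanSpace ℝ (Fin n)) : ‖projOn X x - projOn X y‖ ≤ ‖x - y‖ := by
  set p := projOn X x
  set q := projOn X y
  have hx : inner ℝ (x - p) (q - p) ≤ 0 :=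
    inner_sub_projOn_le_zero hcl hcv x (projOn_mem_and_isMinOn hne hcl y).1
  have hy : inner ℝ (y - q) (p - q) ≤ 0 :=
    inner_sub_projOn_le_zero hcl hcv y (projOn_mem_and_isMinOn hne hcl x).1
  have hsum : inner ℝ (x - p) (q - p) + inner ℝ (y - q) (p - q)
      = ‖p - q‖ ^ 2 - inner ℝ (x - y) (p - q) := by
    rw [← real_inner_self_eq_norm_sq]
    simp only [inner_sub_left, inner_sub_right]
    ring
  have hmul : ‖p - q‖ * ‖p - q‖ ≤ ‖x - y‖ * ‖p - q‖ := by
    linarith [real_inner_le_norm (x - y) (p - q)]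
  rcases (norm_nonneg (p - q)).eq_or_lt with h | h
  · exact h ▸ norm_nonneg _
  · exact le_of_mul_le_mul_right hmul h

lemma measurable_projOn (hne : X.Nonempty) (hcl : IsClosed X) (hcv : Convex ℝ X) :
    Measurable (projOn X) := by
  have hlip : LipschitzWith 1 (projOn X) := LipschitzWith.of_dist_le_mul fun x y => by
    simpa only [dist_eq_norm, NNReal.coe_one, one_mul] using
      norm_projOn_sub_projOn_le hne hcl hcv x y
  exact hlip.continuous.measurable

end Projection

section ConvexCombinations

lemma norm_sum_smul_sub_sum_smul_le {V : Type*} [SeminormedAddCommGroup V] [NormedSpace ℝ V]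
    {ι : Type*} [Fintype ι] {a b : ι → ℝ} (ha : a ∈ stdSimplex ℝ ι) (hb : b ∈ stdSimplex ℝ ι)
    {x : ι → V} {D : ℝ} (hx : ∀ i j, ‖x i - x j‖ ≤ D) :
    ‖∑ i, a i • x i - ∑ j, b j • x j‖ ≤ D := by
  have hmem {c : ι → ℝ} (hc : c ∈ stdSimplex ℝ ι) {C : Set V} (hC : Convex ℝ C)
      (hxC : ∀ i, x i ∈ C) : ∑ i, c i • x i ∈ C :=
    hC.sum_mem (fun i _ => hc.1 i) hc.2 fun i _ => hxC i
  simp only [← dist_eq_norm, ← Metric.mem_closedBall] at hx ⊢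
  refine hmem ha (convex_closedBall _ _) fun i => ?_
  rw [Metric.mem_closedBall_comm]
  exact hmem hb (convex_closedBall _ _) fun j => hx j i

lemma row_mem_stdSimplex {ι : Type*} [Fintype ι] [DecidableEq ι] {A : Matrix ι ι ℝ}
    (hA : A ∈ doublyStochastic ℝ ι) (i : ι) : A i ∈ stdSimplex ℝ ι :=
  ⟨fun _ => nonneg_of_mem_doublyStochastic hA, sum_row_of_mem_doublyStochastic hA i⟩

end ConvexCombinations

namespace SubgradientNetwork

section Network

variable {m n : ℕ} {W : Type*} [MeasurableSpace W] (N : SubgradientNetwork m n W)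

lemma stateFrom_self (s : ℕ) (y : AgentState m n) (ω : ℕ → W) : N.stateFrom s y ω s = y := by
  cases s with
  | zero => rfl
  | succ s => exact if_neg s.not_succ_le_self

lemma stateFrom_succ {s k : ℕ} (h : s ≤ k) (y : AgentState m n) (ω : ℕ → W) :
    N.stateFrom s y ω (k + 1) = N.step k (N.stateFrom s y ω k) (ω k) :=
  if_pos h

lemma measurable_step (k : ℕ) : Measurable fun p : AgentState m n × W => N.step k p.1 p.2 := by
  refine measurable_pi_lambda _ fun i => ?_
  refine (measurable_projOn (N.nonempty_X i) (N.closed_X i) (N.convex_X i)).comp ?_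
  refine (Finset.measurable_fun_sum _ fun j _ => ?_).fun_sub
    ((N.measurable_d k i).fun_const_smul (N.α k))
  exact (N.measurable_ψ i j).fun_smul ((measurable_pi_apply j).comp measurable_fst)

lemma measurable_stateFrom (s : ℕ) (y : AgentState m n) (k : ℕ) :
    Measurable[pastNoise W k] fun ω => N.stateFrom s y ω k := by
  induction k with
  | zero => exact measurable_const
  | succ k ih =>
    by_cases h : s ≤ k
    · have hstep : Measurable[pastNoise W (k + 1)]
          ((fun p : AgentState m n × W => N.step k p.1 p.2) ∘
            fun ω => (N.stateFrom s y ω k, ω k)) :=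
        (N.measurable_step k).comp (measurable_prodMk_noise ih)
      simpa only [stateFrom_succ N h, Function.comp_def] using hstep
    · simp only [stateFrom, h, if_false]
      exact measurable_const

lemma measurable_weightsFrom (s : ℕ) (y : AgentState m n) (k : ℕ) (i j : Fin m) :
    Measurable[pastNoise W (k + 1)] fun ω => N.weightsFrom s y ω k i j :=
  (N.measurable_ψ i j).comp (measurable_prodMk_noise (N.measurable_stateFrom s y k))

section Weights

variable (P : Measure W) [IsProbabilityMeasure P] {s : ℕ} {y : AgentState m n} {γ : ℝ}

lemma mul_le_condExp_weightsFrom (hγ : 0 ≤ γ) (hds : N.DoublyStochasticFrom P s y) {t : ℕ}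
    (ht : s ≤ t) {i j : Fin m} {p : ℝ}
    (hp : ∀ᵐ ω ∂noiseLaw P, p ≤ P.real {w | γ ≤ N.ψ (N.stateFrom s y ω t) w i j}) :
    ∀ᵐ ω ∂noiseLaw P,
      γ * p ≤ ((noiseLaw P)[fun ω => N.weightsFrom s y ω t i j | pastNoise W t]) ω := by
  set T : Set (AgentState m n × W) := {q | γ ≤ N.ψ q.1 q.2 i j}
  have hT : MeasurableSet T := measurableSet_le measurable_const (N.measurable_ψ i j)
  have hmeas (i j : Fin m) : Measurable fun ω => N.weightsFrom s y ω t i j :=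
    (N.measurable_weightsFrom s y t i j).mono ((pastNoise W).le _) le_rfl
  have hX : Measurable fun ω : ℕ → W => (N.stateFrom s y ω t, ω t) :=
    (measurable_prodMk_noise (N.measurable_stateFrom s y t)).mono ((pastNoise W).le _) le_rfl
  set B : Set (ℕ → W) := (fun ω => (N.stateFrom s y ω t, ω t)) ⁻¹' T
  have hmarkov : γ • B.indicator (fun _ => (1 : ℝ)) ≤ᵐ[noiseLaw P]
      fun ω => N.weightsFrom s y ω t i j := by
    filter_upwards [hds] with ω hω
    by_cases hωB : ω ∈ B
    · rw [Pi.smul_apply, Set.indicator_of_mem hωB, smul_eq_mul, mul_one]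
      exact hωB
    · simpa only [Pi.smul_apply, Set.indicator_of_notMem hωB, smul_zero] using
        nonneg_of_mem_doublyStochastic (hω t ht)
  have hmono := condExp_mono (m := pastNoise W t)
    (((integrable_const (1 : ℝ)).indicator (hX hT)).smul γ)
    (integrable_of_ae_doublyStochastic hmeas (hds.mono fun _ hω => hω t ht) i j) hmarkov
  filter_upwards [hmono, condExp_smul γ (B.indicator fun _ => (1 : ℝ)) (pastNoise W t)
    (μ := noiseLaw P), condExp_indicator_noise P (N.measurable_stateFrom s y t) hT,
    hp] with ω hle hsmul hcond hpω
  rw [hsmul, Pi.smul_apply, hcond, smul_eq_mul] at hle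
  exact (mul_le_mul_of_nonneg_left hpω hγ).trans hle

lemma isAveragingProcess_weightsFrom (hγ : 0 ≤ γ) (hds : N.DoublyStochasticFrom P s y)
    (hself : N.SelfConfidentFrom P γ s y) {R : ℕ → Set (AgentState m n)}
    (hR : ∀ᵐ ω ∂noiseLaw P, ∀ t, s ≤ t → N.stateFrom s y ω t ∈ R t)
    {E : Fin m → Fin m → Prop} {p : ℕ → ℝ}
    (hp : ∀ t, ∀ x ∈ R t, ∀ i j, E i j → p t ≤ P.real {w | γ ≤ N.ψ x w i j}) :
    IsAveragingProcess (noiseLaw P) (pastNoise W) E γ (fun t => γ * p t) s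
      (N.weightsFrom s y) where
  measurable := N.measurable_weightsFrom s y
  ae_doublyStochastic := hds
  ae_le_diag := hself
  le_condExp t ht i j hij :=
    N.mul_le_condExp_weightsFrom P hγ hds ht (hR.mono fun _ hω => hp t _ (hω t ht) i j hij)

end Weights

section Reachable

variable {L M : ℝ}

lemma step_mem_reachable (hm : 0 < m) (hsub : ∀ i x, ∀ g ∈ subgradients (N.f i) x, ‖g‖ ≤ L)
    {k : ℕ} {x : AgentState m n} (hx : x ∈ N.reachable L M k) {w : W}
    (hds : N.ψ x w ∈ doublyStochastic ℝ (Fin m))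
    (herr : ∀ i, ‖N.projError k x w i‖ ≤ M * N.α k) :
    N.step k x w ∈ N.reachable L M (k + 1) := by
  intro i h
  have hstep (i : Fin m) : N.step k x w i
      = ∑ j, N.ψ x w i j • x j - (N.α k • N.d k i x w - N.projError k x w i) := by
    simp only [step, projError, preStep]; abel
  have hpert (i : Fin m) : ‖N.α k • N.d k i x w - N.projError k x w i‖ ≤ (L + M) * N.α k := by
    have hd : ‖N.α k • N.d k i x w‖ ≤ N.α k * L := by
      rw [norm_smul, Real.norm_of_nonneg (N.α_pos k).le]
      exact mul_le_mul_of_nonneg_left (hsub i _ _ (N.d_mem k i x w)) (N.α_pos k).le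
    linarith [norm_sub_le (N.α k • N.d k i x w) (N.projError k x w i), herr i]
  have havg : ‖∑ j, N.ψ x w i j • x j - ∑ j, N.ψ x w h j • x j‖ ≤ _ :=
    norm_sum_smul_sub_sum_smul_le (row_mem_stdSimplex hds i) (row_mem_stdSimplex hds h) hx
  have hm' : (1 : ℝ) ≤ m := by exact_mod_cast hm
  have hmul := le_mul_of_one_le_left ((norm_nonneg _).trans (hpert i)) hm'
  rw [hstep i, hstep h, sub_sub_sub_comm, Finset.sum_range_succ]
  linarith [norm_sub_le (∑ j, N.ψ x w i j • x j - ∑ j, N.ψ x w h j • x j)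
    (N.α k • N.d k i x w - N.projError k x w i - (N.α k • N.d k h x w - N.projError k x w h)),
    norm_sub_le (N.α k • N.d k i x w - N.projError k x w i)
      (N.α k • N.d k h x w - N.projError k x w h), hpert i, hpert h]

lemma x₀_mem_reachable (hm : 0 < m) (L M : ℝ) : N.x₀ ∈ N.reachable L M 0 := by
  intro i h
  have hle (j : Fin m) : ‖N.x₀ j‖ ≤ ⨆ j, ‖N.x₀ j‖ :=
    le_ciSup (f := fun j => ‖N.x₀ j‖) (Set.finite_range _).bddAbove j
  have hm' : (1 : ℝ) ≤ m := by exact_mod_cast hm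
  have hmul := le_mul_of_one_le_left ((norm_nonneg _).trans (hle i)) hm'
  rw [Finset.range_zero, Finset.sum_empty]
  linarith [norm_sub_le (N.x₀ i) (N.x₀ h), hle i, hle h]

lemma ae_stateFrom_mem_reachable (hm : 0 < m) (P : Measure W) [IsProbabilityMeasure P]
    (hsub : ∀ i x, ∀ g ∈ subgradients (N.f i) x, ‖g‖ ≤ L)
    {s : ℕ} {y : AgentState m n} (hy : y ∈ N.reachable L M s)
    (hds : N.DoublyStochasticFrom P s y) (herr : N.ProjErrorBoundedFrom P M s y) :
    ∀ᵐ ω ∂noiseLaw P, ∀ t, s ≤ t → N.stateFrom s y ω t ∈ N.reachable L M t := by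
  filter_upwards [hds, herr] with ω hdsω herrω t ht
  induction t, ht using Nat.le_induction with
  | base => rwa [stateFrom_self]
  | succ t ht ih =>
    rw [stateFrom_succ N ht]
    exact N.step_mem_reachable hm hsub ih (hdsω t ht) (herrω t ht)

end Reachable

end Network

end SubgradientNetwork

section Stepsizes

open Asymptotics

lemma mul_rpow_sub_one_mul_sub_le_rpow_sub_rpow {a b ε : ℝ} (ha : 0 ≤ a) (hb : 0 < b)
    (hε₀ : 0 ≤ ε) (hε₁ : ε ≤ 1) : ε * b ^ (ε - 1) * (b - a) ≤ b ^ ε - a ^ ε := by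
  have hbern : (a / b) ^ ε ≤ 1 + ε * (a / b - 1) := by
    have hab : -1 ≤ a / b - 1 := by linarith [div_nonneg ha hb.le]
    simpa only [add_sub_cancel] using rpow_one_add_le_one_add_mul_self hab hε₀ hε₁
  rw [Real.div_rpow ha hb.le, div_le_iff₀ (Real.rpow_pos_of_pos hb ε)] at hbern
  rw [Real.rpow_sub_one hb.ne']
  have hid : ε * (b ^ ε / b) * (b - a) = b ^ ε - (1 + ε * (a / b - 1)) * b ^ ε := by
    field_simp; ring
  linarith

lemma log_rpow_div_le_log_succ_rpow_sub {ε : ℝ} (hε₀ : 0 ≤ ε) (hε₁ : ε ≤ 1) {x : ℝ} (hx : 2 ≤ x) :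
    ε / 4 * (Real.log x ^ (ε - 1) / x) ≤ Real.log (x + 1) ^ ε - Real.log x ^ ε := by
  have hlog : 0 < Real.log x := Real.log_pos (by linarith)
  have hlog' : 0 < Real.log (x + 1) := Real.log_pos (by linarith)
  have hincr : (2 * x)⁻¹ ≤ Real.log (x + 1) - Real.log x := by
    rw [← Real.log_div (by positivity) (by positivity)]
    refine le_trans ?_ (Real.one_sub_inv_le_log_of_pos (by positivity))
    rw [inv_div, one_sub_div (by positivity), add_sub_cancel_left, ← one_div]
    gcongr
    linarith
  have hdouble : Real.log (x + 1) ≤ 2 * Real.log x := by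
    rw [← Real.log_rpow (by positivity), Real.rpow_two]
    exact Real.log_le_log (by positivity) (by nlinarith)
  have hpow : 2⁻¹ * Real.log x ^ (ε - 1) ≤ Real.log (x + 1) ^ (ε - 1) := by
    refine le_trans ?_ (Real.rpow_le_rpow_of_nonpos hlog' hdouble (by linarith))
    rw [Real.mul_rpow zero_le_two hlog.le, ← Real.rpow_neg_one]
    gcongr
    · exact one_le_two
    · linarith
  calc ε / 4 * (Real.log x ^ (ε - 1) / x)
      = ε * (2⁻¹ * Real.log x ^ (ε - 1)) * (2 * x)⁻¹ := by field_simp; norm_num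
    _ ≤ ε * Real.log (x + 1) ^ (ε - 1) * (Real.log (x + 1) - Real.log x) := by gcongr
    _ ≤ _ := mul_rpow_sub_one_mul_sub_le_rpow_sub_rpow hlog.le hlog' hε₀ hε₁

lemma log_rpow_div_isBigO {ε : ℝ} (hε₀ : 0 < ε) (hε₁ : ε ≤ 1) :
    (fun k : ℕ => Real.log k ^ (ε - 1) / k) =O[atTop]
      fun k : ℕ => Real.log ((k + 1 : ℕ) : ℝ) ^ ε - Real.log k ^ ε := by
  refine .of_bound (4 / ε) ?_
  filter_upwards [eventually_ge_atTop 2] with k hk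
  have hle := log_rpow_div_le_log_succ_rpow_sub hε₀.le hε₁ (x := k) (by exact_mod_cast hk)
  have hnonneg : 0 ≤ Real.log k ^ (ε - 1) / k :=
    div_nonneg (Real.rpow_nonneg (Real.log_natCast_nonneg k) _) k.cast_nonneg
  rw [Nat.cast_succ, Real.norm_of_nonneg hnonneg,
    Real.norm_of_nonneg ((mul_nonneg (by positivity) hnonneg).trans hle)]
  calc _ = 4 / ε * (ε / 4 * (Real.log k ^ (ε - 1) / k)) := by field_simp
    _ ≤ _ := by gcongr

lemma sum_range_isLittleO_log_rpow_of_le_one {α : ℕ → ℝ} {ε : ℝ} (hε₀ : 0 < ε) (hε₁ : ε ≤ 1)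
    (hα : Tendsto (fun k : ℕ => (k : ℝ) * Real.log k ^ (1 - ε) * α k) atTop (𝓝 0)) :
    (fun k => ∑ r ∈ Finset.range k, α r) =o[atTop] fun k : ℕ => Real.log k ^ ε := by
  have hlittle : α =o[atTop] fun k : ℕ => Real.log k ^ (ε - 1) / k := by
    refine isLittleO_of_tendsto' ?_ (hα.congr' ?_)
    · filter_upwards [eventually_ge_atTop 2] with k hk h
      have hk' : (2 : ℝ) ≤ k := by exact_mod_cast hk
      have := Real.log_pos (show (1 : ℝ) < k by linarith)
      exact absurd h (by positivity)
    · refine .of_forall fun k => ?_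
      have hneg := Real.rpow_neg (Real.log_natCast_nonneg k) (ε - 1)
      rw [neg_sub] at hneg
      simp only [hneg, div_eq_mul_inv, mul_inv, inv_inv]
      ring
  have hsum (k : ℕ) : ∑ r ∈ Finset.range k,
      (Real.log ((r + 1 : ℕ) : ℝ) ^ ε - Real.log r ^ ε) = Real.log k ^ ε := by
    rw [Finset.sum_range_sub fun r : ℕ => Real.log r ^ ε, Nat.cast_zero, Real.log_zero,
      Real.zero_rpow hε₀.ne', sub_zero]
  have hmono (k : ℕ) : Real.log k ≤ Real.log ((k + 1 : ℕ) : ℝ) := by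
    rcases k.eq_zero_or_pos with rfl | hk
    · rw [Nat.cast_zero, Real.log_zero]
      exact Real.log_natCast_nonneg _
    · exact Real.log_le_log (by exact_mod_cast hk) (by exact_mod_cast k.le_succ)
  have htendsto : Tendsto (fun k : ℕ => Real.log k ^ ε) atTop atTop :=
    (tendsto_rpow_atTop hε₀).comp (Real.tendsto_log_atTop.comp tendsto_natCast_atTop_atTop)
  simpa only [hsum] using (hlittle.trans_isBigO (log_rpow_div_isBigO hε₀ hε₁)).sum_range
    (fun k => sub_nonneg.2 (Real.rpow_le_rpow (Real.log_natCast_nonneg k) (hmono k) hε₀.le))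
    (by simpa only [hsum] using htendsto)

lemma log_rpow_isBigO_log_rpow {a b : ℝ} (hab : a ≤ b) :
    (fun k : ℕ => Real.log k ^ a) =O[atTop] fun k : ℕ => Real.log k ^ b := by
  refine .of_bound' ?_
  filter_upwards [(Real.tendsto_log_atTop.comp tendsto_natCast_atTop_atTop).eventually_ge_atTop 1]
    with k (hk : 1 ≤ Real.log k)
  rw [Real.norm_of_nonneg (by positivity), Real.norm_of_nonneg (by positivity)]
  exact Real.rpow_le_rpow_of_exponent_le hk hab

lemma sum_range_isBigO_log_rpow {α : ℕ → ℝ}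
    (hα : ∀ p : ℝ, p < 1 →
      Tendsto (fun k : ℕ => (k : ℝ) * Real.log k ^ p * α k) atTop (𝓝 0))
    {ε : ℝ} (hε : 0 < ε) :
    (fun k => ∑ r ∈ Finset.range k, α r) =O[atTop] fun k : ℕ => Real.log k ^ ε :=
  (sum_range_isLittleO_log_rpow_of_le_one (lt_min hε one_pos) (min_le_right ε 1)
    (hα _ (sub_lt_self 1 (lt_min hε one_pos)))).isBigO.trans
    (log_rpow_isBigO_log_rpow (min_le_left ε 1))

end Stepsizes

section Decay

open Asymptotics

lemma one_le_log_add_three (k : ℕ) : 1 ≤ Real.log ((k : ℝ) + 3) := by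
  rw [Real.le_log_iff_exp_le (by positivity)]
  linarith [Real.exp_one_lt_d9, k.cast_nonneg (α := ℝ)]

lemma sqrt_log_add_one_div_le {a : ℝ} (ha : 0 < a) {t : ℝ} (ht : 0 ≤ t) :
    √(Real.log (t + 1)) / a ≤ √t + 1 / (2 * a ^ 2) := by
  have hlog : Real.log (t + 1) ≤ 2 * √t := by
    have hsq : Real.log (t + 1) ≤ 2 * Real.log (1 + √t) := by
      rw [← Real.log_rpow (by positivity), Real.rpow_two]
      refine Real.log_le_log (by positivity) ?_
      nlinarith [Real.sq_sqrt ht, Real.sqrt_nonneg t]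
    linarith [Real.log_le_sub_one_of_pos (x := 1 + √t) (by positivity)]
  have hamgm : √(Real.log (t + 1)) / a ≤ √(Real.log (t + 1)) ^ 2 / 2 + 1 / (2 * a ^ 2) := by
    have h := two_mul_le_add_sq √(Real.log (t + 1)) (1 / a)
    field_simp at h ⊢
    linarith
  rw [Real.sq_sqrt (Real.log_nonneg (by linarith))] at hamgm
  linarith

lemma sqrt_log_add_add_three_le {s t : ℝ} (hs : 0 ≤ s) (ht : 0 ≤ t) :
    √(Real.log (s + t + 3)) ≤ √(Real.log (s + 3)) + √(Real.log (t + 1)) := by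
  have hs' : 0 ≤ Real.log (s + 3) := Real.log_nonneg (by linarith)
  have ht' : 0 ≤ Real.log (t + 1) := Real.log_nonneg (by linarith)
  have hlog : Real.log (s + t + 3) ≤ Real.log (s + 3) + Real.log (t + 1) := by
    rw [← Real.log_mul (by positivity) (by positivity)]
    exact Real.log_le_log (by positivity) (by nlinarith)
  refine Real.sqrt_le_iff.2 ⟨by positivity, ?_⟩
  rw [add_sq, Real.sq_sqrt hs', Real.sq_sqrt ht']
  linarith [mul_nonneg (Real.sqrt_nonneg (Real.log (s + 3))) (Real.sqrt_nonneg (Real.log (t + 1)))]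

lemma sqrt_sub_le_mul_div_sqrt_log {a s t : ℝ} (ha : 0 < a) (hs : 0 ≤ s) (ht : 0 ≤ t) :
    √t - (1 / (2 * a ^ 2) + √(Real.log (s + 3)) / a) ≤ a * (t / √(Real.log (s + t + 3))) := by
  set l := √(Real.log (s + t + 3))
  have hl₀ : 0 < l := Real.sqrt_pos.2 (Real.log_pos (by linarith))
  have hamgm : 2 * √t ≤ a * (t / l) + l / a := by
    have h := two_mul_le_add_sq (a * √t) l
    rw [mul_pow, Real.sq_sqrt ht] at h
    field_simp
    linarith
  have hsplit : l / a ≤ √(Real.log (s + 3)) / a + √(Real.log (t + 1)) / a := by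
    rw [← add_div]
    gcongr
    exact sqrt_log_add_add_three_le hs ht
  linarith [sqrt_log_add_one_div_le ha ht]

lemma sub_div_sqrt_log_le_sum {s k : ℕ} (hsk : s ≤ k) :
    ((k : ℝ) - s) / √(Real.log (k + 3)) ≤ ∑ t ∈ Finset.Icc s k, 1 / √(Real.log (t + 3)) := by
  have hpos (t : ℕ) : 0 < √(Real.log ((t : ℝ) + 3)) :=
    Real.sqrt_pos.2 (zero_lt_one.trans_le (one_le_log_add_three t))
  have hcard := Finset.card_nsmul_le_sum (Finset.Icc s k) (fun t => 1 / √(Real.log ((t : ℝ) + 3)))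
    (1 / √(Real.log ((k : ℝ) + 3))) fun t ht => by
      have := (Finset.mem_Icc.1 ht).2
      have := hpos t
      gcongr
  rw [Nat.card_Icc, nsmul_eq_mul, mul_one_div, Nat.cast_sub (by lia), Nat.cast_succ] at hcard
  refine le_trans ?_ hcard
  gcongr
  linarith

/-- The price, at time `s`, of turning a decay rate `a / √(log (t + 3))` at each time `t ≥ s` into
the decay `exp (-√(k - s))`. -/
noncomputable def transientFactor (a : ℝ) (s : ℕ) : ℝ :=
  Real.exp (1 / (2 * a ^ 2) + √(Real.log (s + 3)) / a)

lemma exp_neg_mul_sum_le_transientFactor_mul {a : ℝ} (ha : 0 < a) {s k : ℕ} (hsk : s ≤ k) :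
    Real.exp (-(a * ∑ t ∈ Finset.Icc s k, 1 / √(Real.log (t + 3))))
      ≤ transientFactor a s * Real.exp (-√((k : ℝ) - s)) := by
  have hrate := sqrt_sub_le_mul_div_sqrt_log ha (s := s) (t := k - s) s.cast_nonneg
    (sub_nonneg.2 (by exact_mod_cast hsk))
  rw [add_sub_cancel] at hrate
  rw [transientFactor, ← Real.exp_add, Real.exp_le_exp]
  linarith [mul_le_mul_of_nonneg_left (sub_div_sqrt_log_le_sum hsk) ha.le]

lemma transientFactor_pos (a : ℝ) (s : ℕ) : 0 < transientFactor a s :=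
  Real.exp_pos _

lemma strictMono_transientFactor {a : ℝ} (ha : 0 < a) : StrictMono (transientFactor a) := by
  intro s t hst
  have hlog : 0 ≤ Real.log ((s : ℝ) + 3) := zero_le_one.trans (one_le_log_add_three s)
  unfold transientFactor
  gcongr

lemma transientFactor_isLittleO_rpow {a q : ℝ} (ha : 0 < a) (hq : 0 < q) :
    transientFactor a =o[atTop] fun s : ℕ => (s : ℝ) ^ q := by
  have hexp : (fun s : ℕ => Real.exp (Real.log s * q)) =ᶠ[atTop] fun s : ℕ => (s : ℝ) ^ q := by
    filter_upwards [eventually_gt_atTop 0] with s hs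
    rw [Real.rpow_def_of_pos (by exact_mod_cast hs)]
  refine IsLittleO.trans_eventuallyEq (Real.isLittleO_exp_comp_exp_comp.2 ?_) hexp
  have hlog : Tendsto (fun s : ℕ => Real.log s) atTop atTop :=
    Real.tendsto_log_atTop.comp tendsto_natCast_atTop_atTop
  refine tendsto_atTop_mono' _ ?_ (tendsto_atTop_add_const_right _
    (-(1 / (2 * a ^ 2) + 1 / (a ^ 2 * q))) (hlog.const_mul_atTop (half_pos hq)))
  filter_upwards [eventually_ge_atTop 3] with s hs
  have hs' : (3 : ℝ) ≤ s := by exact_mod_cast hs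
  have hdouble : Real.log ((s : ℝ) + 3) ≤ 2 * Real.log s := by
    rw [← Real.log_rpow (by positivity), Real.rpow_two]
    exact Real.log_le_log (by positivity) (by nlinarith)
  have hamgm : √(Real.log ((s : ℝ) + 3)) / a
      ≤ q / 4 * √(Real.log ((s : ℝ) + 3)) ^ 2 + 1 / (a ^ 2 * q) := by
    have h := sq_nonneg (a * q * √(Real.log ((s : ℝ) + 3)) - 2)
    field_simp
    linarith
  rw [Real.sq_sqrt (zero_le_one.trans (one_le_log_add_three s))] at hamgm
  linarith [mul_le_mul_of_nonneg_left hdouble hq.le]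

lemma exists_forall_mul_transientFactor_le_rpow {a : ℝ} (ha : 0 < a) (D : ℝ) :
    ∃ S : ℝ → ℕ, ∀ q : ℝ, 0 < q → ∀ s : ℕ, S q ≤ s → D * transientFactor a s ≤ (s : ℝ) ^ q := by
  have hlim (q : ℝ) (hq : 0 < q) : ∃ S : ℕ, ∀ s ≥ S, D * transientFactor a s ≤ (s : ℝ) ^ q := by
    refine eventually_atTop.1 ?_
    filter_upwards [((transientFactor_isLittleO_rpow ha hq).const_mul_left D).eventuallyLE]
      with s hs
    rw [Real.norm_of_nonneg (Real.rpow_nonneg s.cast_nonneg q)] at hs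
    exact (le_abs_self _).trans hs
  choose! S hS using hlim
  exact ⟨S, hS⟩

end Decay

lemma ofReal_div_sqrt_le_min {δ K C R l r : ℝ} (hδ : 0 ≤ δ) (hC : 0 < C) (hR : 0 < R)
    (hl : 1 ≤ l) (hr : r ≤ R * l ^ (1 / (2 * C))) :
    ENNReal.ofReal (min δ (K / R ^ C) / √l) ≤
      min (ENNReal.ofReal δ) (ENNReal.ofReal K / ENNReal.ofReal r ^ C) := by
  have hl₀ : 0 < l := one_pos.trans_le hl
  have hpow : (R * l ^ (1 / (2 * C))) ^ C = R ^ C * √l := by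
    rw [Real.mul_rpow hR.le (by positivity), ← Real.rpow_mul hl₀.le, Real.sqrt_eq_rpow]
    congr 2
    field_simp
  refine le_min (ENNReal.ofReal_le_ofReal ?_) ?_
  · calc min δ (K / R ^ C) / √l ≤ δ / √l := by gcongr; exact min_le_left _ _
      _ ≤ δ := div_le_self hδ (Real.one_le_sqrt.2 hl)
  · calc ENNReal.ofReal (min δ (K / R ^ C) / √l)
        ≤ ENNReal.ofReal (K / R ^ C / √l) := by gcongr; exact min_le_right _ _
      _ = ENNReal.ofReal K / ENNReal.ofReal (R * l ^ (1 / (2 * C))) ^ C := by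
        rw [ENNReal.ofReal_rpow_of_pos (by positivity), hpow, div_div,
          ENNReal.ofReal_div_of_pos (by positivity)]
      _ ≤ _ := by gcongr

section TowerProperty

variable {Ω : Type*} {𝓗 𝓖 mΩ : MeasurableSpace Ω} {μ : Measure Ω} {f : Ω → ℝ} {c : ℝ}

lemma condExp_le_const_of_le [IsFiniteMeasure μ] (hle : 𝓗 ≤ 𝓖) (h𝓖 : 𝓖 ≤ mΩ)
    (h : ∀ᵐ ω ∂μ, (μ[f | 𝓖]) ω ≤ c) : ∀ᵐ ω ∂μ, (μ[f | 𝓗]) ω ≤ c := by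
  have hmono : μ[μ[f | 𝓖] | 𝓗] ≤ᵐ[μ] μ[fun _ => c | 𝓗] :=
    condExp_mono integrable_condExp (integrable_const c) h
  filter_upwards [condExp_condExp_of_le (f := f) hle h𝓖 (μ := μ), hmono] with ω htower hω
  rwa [htower, condExp_const (hle.trans h𝓖)] at hω

lemma integral_le_of_condExp_le [IsProbabilityMeasure μ] (h𝓖 : 𝓖 ≤ mΩ)
    (h : ∀ᵐ ω ∂μ, (μ[f | 𝓖]) ω ≤ c) : ∫ ω, f ω ∂μ ≤ c := by
  rw [← integral_condExp h𝓖]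
  simpa only [integral_const, probReal_univ, one_smul] using
    integral_mono_ae integrable_condExp (integrable_const c) h

end TowerProperty

namespace SubgradientNetwork

section Communication

open Asymptotics

variable {m n : ℕ} {W : Type*} [MeasurableSpace W] (N : SubgradientNetwork m n W) {L M : ℝ}

lemma exists_norm_sub_le_of_mem_reachable {ε : ℝ} (hε : 0 ≤ ε)
    (hsum : (fun k => ∑ r ∈ Finset.range k, N.α r) =O[atTop] fun k : ℕ => Real.log k ^ ε) :
    ∃ R > 0, ∀ t, ∀ x ∈ N.reachable L M t, ∀ i j,
      ‖x i - x j‖ ≤ R * Real.log (t + 3) ^ ε := by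
  have hone (t : ℕ) : 1 ≤ Real.log ((t : ℝ) + 3) ^ ε :=
    Real.one_le_rpow (one_le_log_add_three t) hε
  have hconst (a : ℝ) : (fun _ : ℕ => a) =O[atTop] fun t : ℕ => Real.log ((t : ℝ) + 3) ^ ε :=
    .of_bound |a| (.of_forall fun t => le_mul_of_one_le_right (abs_nonneg a)
      ((hone t).trans (le_abs_self _)))
  have hshift : (fun t : ℕ => Real.log t ^ ε) =O[atTop]
      fun t : ℕ => Real.log ((t : ℝ) + 3) ^ ε := by
    refine .of_bound' ?_
    filter_upwards [eventually_gt_atTop 0] with t ht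
    have hlog := Real.log_le_log (by exact_mod_cast ht) (by linarith : (t : ℝ) ≤ t + 3)
    have hlog₀ := Real.log_natCast_nonneg t
    rw [Real.norm_of_nonneg (by positivity), Real.norm_of_nonneg (one_pos.le.trans (hone t))]
    exact Real.rpow_le_rpow hlog₀ hlog hε
  obtain ⟨R, hR, hbound⟩ := bound_of_isBigO_nat_atTop
    ((hconst (2 * m * ⨆ j, ‖N.x₀ j‖)).add
      ((hsum.trans hshift).const_mul_left (2 * m * (L + M))))
  refine ⟨R, hR, fun t x hx i j => ?_⟩
  have hpos : 0 < Real.log ((t : ℝ) + 3) ^ ε := one_pos.trans_le (hone t)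
  simpa only [Real.norm_of_nonneg hpos.le] using
    (hx i j).trans ((le_abs_self _).trans (hbound hpos.ne'))

lemma exists_div_sqrt_log_le_measureReal (P : Measure W) [IsFiniteMeasure P]
    {E : Fin m → Fin m → Prop} {γ δ K C : ℝ} (hδ : 0 < δ) (hK : 0 < K) (hC : 0 < C)
    (hcomm : ∀ i j, E i j → ∀ x : AgentState m n,
      min (ENNReal.ofReal δ) (ENNReal.ofReal K / ENNReal.ofReal ‖x i - x j‖ ^ C) ≤
        P {w | γ ≤ N.ψ x w i j})
    (hsum : (fun k => ∑ r ∈ Finset.range k, N.α r) =O[atTop]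
      fun k : ℕ => Real.log k ^ (1 / (2 * C))) :
    ∃ c > 0, ∀ t : ℕ, ∀ x ∈ N.reachable L M t, ∀ i j, E i j →
      c * (1 / √(Real.log (t + 3))) ≤ P.real {w | γ ≤ N.ψ x w i j} := by
  obtain ⟨R, hR, hdiam⟩ :=
    N.exists_norm_sub_le_of_mem_reachable (L := L) (M := M) (by positivity) hsum
  refine ⟨min δ (K / R ^ C), lt_min hδ (by positivity), fun t x hx i j hij => ?_⟩
  rw [mul_one_div, measureReal_def, ← ENNReal.ofReal_le_iff_le_toReal (measure_ne_top _ _)]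
  exact (ofReal_div_sqrt_le_min hδ.le hC hR (one_le_log_add_three t)
    (hdiam t x hx i j)).trans (hcomm i j hij x)

lemma condExp_disagreement_weightsFrom_le (hm : 0 < m) (P : Measure W) [IsProbabilityMeasure P]
    (hsub : ∀ i x, ∀ g ∈ subgradients (N.f i) x, ‖g‖ ≤ L)
    {E : Fin m → Fin m → Prop} {γ κ c : ℝ} (hγ : 0 < γ) (hκ : 0 < κ) (hc : 0 < c)
    (hE : ∀ z, κ * sqDeviation z ≤ edgeEnergy E z)
    (hp : ∀ t : ℕ, ∀ x ∈ N.reachable L M t, ∀ i j, E i j →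
      c * (1 / √(Real.log (t + 3))) ≤ P.real {w | γ ≤ N.ψ x w i j})
    {r s k : ℕ} (hrs : r ≤ s) (hsk : s ≤ k) {y : AgentState m n} (hy : y ∈ N.reachable L M r)
    (hds : N.DoublyStochasticFrom P r y) (hself : N.SelfConfidentFrom P γ r y)
    (herr : N.ProjErrorBoundedFrom P M r y)
    {Φ : (ℕ → Matrix (Fin m) (Fin m) ℝ) → ℕ → ℕ → Matrix (Fin m) (Fin m) ℝ}
    (hΦ : Φ ∈ ({backwardProduct, forwardProduct} : Set _)) :
    Integrable (fun ω => disagreement (Φ (N.weightsFrom r y ω) k s)) (noiseLaw P) ∧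
      ∀ᵐ ω ∂noiseLaw P,
        ((noiseLaw P)[fun ω => disagreement (Φ (N.weightsFrom r y ω) k s) | pastNoise W s]) ω
          ≤ √m * transientFactor (γ * κ / 4 * (γ * c)) s * Real.exp (-√((k : ℝ) - s)) := by
  have hproc := (N.isAveragingProcess_weightsFrom P hγ.le hds hself
    (N.ae_stateFrom_mem_reachable hm P hsub hy hds herr) hp).mono hrs
  obtain ⟨hint, hbound⟩ :=
    hproc.condExp_disagreement_le hm hγ.le (fun t => by positivity) hE hsk hΦ
  refine ⟨hint, hbound.mono fun ω hω => hω.trans ?_⟩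
  have hdecay := exp_neg_mul_sum_le_transientFactor_mul (a := γ * κ / 4 * (γ * c))
    (by positivity) hsk
  rw [mul_assoc √m]
  refine mul_le_mul_of_nonneg_left ?_ (Real.sqrt_nonneg _)
  simpa only [mul_assoc, ← Finset.mul_sum] using hdecay

end Communication

end SubgradientNetwork

theorem mainTheorem3_general {m n : ℕ} (hm : 0 < m) {W : Type*} [MeasurableSpace W]
    (P : Measure W) [IsProbabilityMeasure P] (N : SubgradientNetwork m n W)
    (L : ℝ) (hsub : ∀ i x, ∀ g ∈ subgradients (N.f i) x, ‖g‖ ≤ L)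
    (G : Digraph (Fin m)) (hconn : ∀ i j, Relation.ReflTransGen G.Adj i j)
    (γ δ K C : ℝ) (hγ : 0 < γ) (hδ : 0 < δ) (hK : 0 < K) (hC : 0 < C)
    (hcomm : ∀ i j, G.Adj j i → ∀ x : AgentState m n,
      min (ENNReal.ofReal δ) (ENNReal.ofReal K / ENNReal.ofReal ‖x i - x j‖ ^ C) ≤
        P {w | γ ≤ N.ψ x w i j})
    (hds : N.DoublyStochasticFrom P 0 N.x₀) (hself : N.SelfConfidentFrom P γ 0 N.x₀)
    (hsum : (fun k => ∑ r ∈ Finset.range k, N.α r) =O[atTop]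
      fun k : ℕ => Real.log k ^ (1 / (2 * C)))
    (M : ℝ) (herr : N.ProjErrorBoundedFrom P M 0 N.x₀) :
    ∃ μ : ℝ, 0 < μ ∧ ∃ β : ℕ → ℝ, (∀ s, 0 ≤ β s) ∧ StrictMono β ∧
      (∃ S : ℝ → ℕ, ∀ q : ℝ, 0 < q → ∀ s : ℕ, S q ≤ s → β s ≤ (s : ℝ) ^ q) ∧
      ∀ Φ ∈ ({backwardProduct, forwardProduct} :
          Set ((ℕ → Matrix (Fin m) (Fin m) ℝ) → ℕ → ℕ → Matrix (Fin m) (Fin m) ℝ)),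
        ∀ k s : ℕ, s ≤ k →
          (∀ y ∈ N.reachable L M s,
            N.DoublyStochasticFrom P s y → N.SelfConfidentFrom P γ s y →
            N.ProjErrorBoundedFrom P M s y →
            Integrable (fun ω => disagreement (Φ (N.weightsFrom s y ω) k s))
                (SubgradientNetwork.noiseLaw P) ∧
              ∫ ω, disagreement (Φ (N.weightsFrom s y ω) k s) ∂(SubgradientNetwork.noiseLaw P)
                ≤ β s * Real.exp (-μ * Real.sqrt ((k : ℝ) - s))) ∧
          Integrable (fun ω => disagreement (Φ (N.weightsFrom 0 N.x₀ ω) k s))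
              (SubgradientNetwork.noiseLaw P) ∧
          ∀ᵐ ω ∂(SubgradientNetwork.noiseLaw P),
            ((SubgradientNetwork.noiseLaw P)[fun ω' =>
                disagreement (Φ (N.weightsFrom 0 N.x₀ ω') k s) |
              MeasurableSpace.comap (fun ω' => N.stateFrom 0 N.x₀ ω' s) inferInstance]) ω
              ≤ β s * Real.exp (-μ * Real.sqrt ((k : ℝ) - s)) := by
  obtain ⟨κ, hκ, hE⟩ := exists_mul_sqDeviation_le_edgeEnergy fun i j => (hconn j i).swap
  obtain ⟨c, hc, hp⟩ :=
    N.exists_div_sqrt_log_le_measureReal (L := L) (M := M) P hδ hK hC hcomm hsum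
  set a := γ * κ / 4 * (γ * c)
  have ha : 0 < a := by positivity
  have hsqrt : 0 < √(m : ℝ) := by positivity
  refine ⟨1, one_pos, fun s => √m * transientFactor a s,
    fun s => (mul_pos hsqrt (transientFactor_pos a s)).le,
    (strictMono_transientFactor ha).const_mul hsqrt,
    exists_forall_mul_transientFactor_le_rpow ha √m, fun Φ hΦ k s hsk => ?_⟩
  simp only [neg_one_mul]
  refine ⟨fun y hy hdsy hselfy herry => ?_, ?_⟩
  · obtain ⟨hint, hbound⟩ := N.condExp_disagreement_weightsFrom_le hm P hsub hγ hκ hc hE hp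
      le_rfl hsk hy hdsy hselfy herry hΦ
    exact ⟨hint, integral_le_of_condExp_le ((pastNoise W).le s) hbound⟩
  · obtain ⟨hint, hbound⟩ := N.condExp_disagreement_weightsFrom_le hm P hsub hγ hκ hc hE hp
      s.zero_le hsk (N.x₀_mem_reachable hm L M) hds hself herr hΦ
    exact ⟨hint, condExp_le_const_of_le (N.measurable_stateFrom 0 N.x₀ s).comap_le
      ((pastNoise W).le s) hbound⟩

theorem mainTheorem3 {m n : ℕ} (hm : 0 < m) {W : Type*} [MeasurableSpace W]
    (P : Measure W) [IsProbabilityMeasure P] (N : SubgradientNetwork m n W)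
    -- bounded subgradients
    (L : ℝ) (hL : 0 < L) (hsub : ∀ i x, ∀ g ∈ subgradients (N.f i) x, ‖g‖ ≤ L)
    -- strongly connected communication graph; an edge `(j, i)` is `G.Adj j i`
    (G : Digraph (Fin m)) (hconn : ∀ i j, Relation.ReflTransGen G.Adj i j)
    -- probability of communication along the edges, with `K / 0 = ∞`
    (γ δ K C : ℝ) (hγ : 0 < γ) (hδ : δ ∈ Set.Ioc (0 : ℝ) 1) (hK : 0 < K) (hC : 0 < C)
    (hcomm : ∀ i j, G.Adj j i → ∀ x : AgentState m n,
      min (ENNReal.ofReal δ) (ENNReal.ofReal K / ENNReal.ofReal ‖x i - x j‖ ^ C) ≤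
        P {w | γ ≤ N.ψ x w i j})
    -- doubly stochastic weights, self confidence
    (hds : N.DoublyStochasticFrom P 0 N.x₀) (hself : N.SelfConfidentFrom P γ 0 N.x₀)
    -- limiting stepsizes
    (hstep : ∀ p : ℝ, p < 1 →
      Tendsto (fun k : ℕ => (k : ℝ) * Real.log k ^ p * N.α k) atTop (𝓝 0))
    -- bounded projection errors
    (M : ℝ) (hM : 0 < M) (herr : N.ProjErrorBoundedFrom P M 0 N.x₀) :
    ∃ μ : ℝ, 0 < μ ∧ ∃ β : ℕ → ℝ, (∀ s, 0 ≤ β s) ∧ StrictMono β ∧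
      (∃ S : ℝ → ℕ, ∀ q : ℝ, 0 < q → ∀ s : ℕ, S q ≤ s → β s ≤ (s : ℝ) ^ q) ∧
      ∀ Φ ∈ ({backwardProduct, forwardProduct} :
          Set ((ℕ → Matrix (Fin m) (Fin m) ℝ) → ℕ → ℕ → Matrix (Fin m) (Fin m) ℝ)),
        ∀ k s : ℕ, s ≤ k →
          -- the bound given `x(s) = y`, for every `y` in `R_M(s)` (Markov transition law)
          (∀ y ∈ N.reachable L M s,
            N.DoublyStochasticFrom P s y → N.SelfConfidentFrom P γ s y →
            N.ProjErrorBoundedFrom P M s y →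
            Integrable (fun ω => disagreement (Φ (N.weightsFrom s y ω) k s))
                (SubgradientNetwork.noiseLaw P) ∧
              ∫ ω, disagreement (Φ (N.weightsFrom s y ω) k s) ∂(SubgradientNetwork.noiseLaw P)
                ≤ β s * Real.exp (-μ * Real.sqrt ((k : ℝ) - s))) ∧
          -- the bound on the conditional expectation given `x(s)`, for the algorithm from `x₀`
          Integrable (fun ω => disagreement (Φ (N.weightsFrom 0 N.x₀ ω) k s))
              (SubgradientNetwork.noiseLaw P) ∧
          ∀ᵐ ω ∂(SubgradientNetwork.noiseLaw P),
            ((SubgradientNetwork.noiseLaw P)[fun ω' =>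
                disagreement (Φ (N.weightsFrom 0 N.x₀ ω') k s) |
              MeasurableSpace.comap (fun ω' => N.stateFrom 0 N.x₀ ω' s) inferInstance]) ω
              ≤ β s * Real.exp (-μ * Real.sqrt ((k : ℝ) - s)) :=
  mainTheorem3_general hm P N L hsub G hconn γ δ K C hγ hδ.1 hK hC hcomm hds hself
    (sum_range_isBigO_log_rpow hstep (by positivity)) M herr
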